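/- Hypergraphs. A hypergraph $H$ consists of finite nonempty sets $V(H)$ (vertices) and $E(H)$ (edges), where each edge is a nonempty subset of $V(H)$ (edges may be repeated) and the edges cover $V(H)$. A morphism is a pair of maps on vertices and on edges that preserves the relation $v\in e$. A path of length $n$ is a sequence $(v_0,e_1,v_1,\dots,e_n,v_n)$ with $v_{i-1},v_i\in e_i$ for $1\le i\le n$; $H$ is connected if any two vertices are joined by a path. A cycle is a path with $n>1$ and $v_n=v_0$. A cycle $C$ is prime if it contains no subsequence $(e,v,e)$ of consecutive terms, neither does $C^2$, and $C\ne D^m$ for every cycle $D$ and $m>1$. Two prime cycles are equivalent if they differ only in the choice of the initial vertex; $[C]$ is the class and $\ell(C)$ the length of $C$. (Prime cycles may be allowed to have $v_{i-1}=v_i$ for some $i$, or this may be forbidden; fix either convention for all hypergraphs. The result holds for both.) The Ihara zeta function is $\zeta_H(u)=\prod_{[C]}(1-u^{\ell(C)})^{-1}$, over all classes of prime cycles of $H$. Coverings. An action of a group $G$ on $Y$ by automorphisms is free if no $g\ne 1$ fixes a vertex or an edge and $v\in e$ implies $gv\notin e$ for all $g\neq 1$. The quotient $Y/G$ has as vertices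 and edges the $G$-orbits of vertices and of edges, with $[e]=\{[v]: v\in e\}$. A morphism $\pi:Y\to X$ is a free Galois covering with Galois group $G$ if $G$ acts freely on $Y$, $X$ is isomorphic to $Y/G$ in such a way that $\pi$ becomes the projection, and $G$ is isomorphic to the group of automorphisms $\sigma$ of $Y$ with $\pi\circ\sigma=\pi$. Frobenius elements. Let $Y$ be connected and $\pi:Y\to X$ a free Galois covering with Galois group $G$. Let $B_X$ be the bipartite graph with vertex set $V(X)\sqcup E(X)$ in which $v$ and $e$ are adjacent iff $v\in e$. Choose a spanning tree $T$ of $B_X$, a vertex $v_0$ of $X$ and a vertex $v_0'$ of $Y$ above it. The identity sheet consists of the terminal vertices of the lifts, with initial vertex $v_0'$, of those paths of $X$ starting at $v_0$ that correspond to simple paths in $T$. A vertex $v$ of $Y$ has sheet number $g\in G$ if $v=gw$ for some $w$ in the identity sheet. For a prime cycle $C$ of $X$, the Frobenius element $F(C,Y/X)\in G$ is the sheet number of the terminal vertex of the lift of $C$ whose initial vertex has sheet number $1$. For a finite-dimensional representation $\rho$ of $G$, $$L(u,\rho,Y/X)=\prod_{[C]}\det\bigl(1-\rho(F(C,Y/X))\,u^{\ell(C)}\bigr)^{-1},$$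 over all classes of prime cycles of $X$, with one representative $C$ chosen in each class. Theorem. Let $Y$ be a connected hypergraph, $\pi:Y\to X$ a free Galois covering with Galois group $G$, and $\rho_G$ the right regular representation of $G$, that is, $(\rho_G(g)f)(x)=f(xg)$ on functions on $G$. Then $T,v_0,v_0'$ as above exist, each $F(C,Y/X)$ is well defined, and for every choice of $T$, $v_0$, $v_0'$ and of the representatives of the classes $[C]$, $$L(u,\rho_G,Y/X)=\zeta_Y(u).$$ This holds as an identity of convergent infinite products of formal power series in $u$ over any field $k$ with a Hausdorff ring topology, for instance the discrete one (with $k[[u]]$ carrying the topology of coefficientwise convergence and $\rho_G$ taken over $k$), and also as an identity of unconditionally convergent products of complex numbers for all $u\in\mathbb C$ with $|u|$ sufficiently small (with $\rho_G$ taken over $\mathbb C$). -/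

import Mathlib

open scoped PowerSeries.WithPiTopology

/-- A hypergraph with vertex set `V` and edge set `E`: both sets are finite and nonempty, every
edge is (labelled by) a nonempty set of vertices, and the edges cover the vertices.
Repeated edges are allowed, since `edge` need not be injective. -/
structure FinHypergraph (V : Type*) (E : Type*) where
  finite_vertices : Finite V
  finite_edges : Finite E
  nonempty_vertices : Nonempty V
  nonempty_edges : Nonempty E
  edge : E → Set V
  edge_nonempty : ∀ e, (edge e).Nonempty
  cover : ⋃ e, edge e = Set.univ

namespace FinHypergraph

variable {V E V' E' : Type*}

/-- Morphisms of hypergraphs: pairs of maps preserving incidence. -/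
structure Hom (Y : FinHypergraph V E) (X : FinHypergraph V' E') where
  onV : V → V'
  onE : E → E'
  map_mem : ∀ v e, v ∈ Y.edge e → onV v ∈ X.edge (onE e)

/-- Isomorphisms of hypergraphs: bijections on vertices and on edges which preserve incidence
in both directions. -/
structure Iso (Y : FinHypergraph V E) (X : FinHypergraph V' E') where
  onV : V ≃ V'
  onE : E ≃ E'
  map_mem_iff : ∀ v e, onV v ∈ X.edge (onE e) ↔ v ∈ Y.edge e

/-- The group of automorphisms `σ` of `Y` with `π ∘ σ = π`. -/
def deckGroup {Y : FinHypergraph V E} {X : FinHypergraph V' E'} (π : Hom Y X) :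
    Subgroup (Equiv.Perm V × Equiv.Perm E) where
  carrier := {σ | (∀ v e, σ.1 v ∈ Y.edge (σ.2 e) ↔ v ∈ Y.edge e) ∧
    (∀ v, π.onV (σ.1 v) = π.onV v) ∧ (∀ e, π.onE (σ.2 e) = π.onE e)}
  one_mem' := by simp
  mul_mem' := by
    rintro σ τ ⟨h1, h2, h3⟩ ⟨k1, k2, k3⟩
    refine ⟨fun v e => ?_, fun v => ?_, fun e => ?_⟩
    · simp [h1, k1]
    · simp [h2, k2]
    · simp [h3, k3]
  inv_mem' := by
    rintro σ ⟨h1, h2, h3⟩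
    refine ⟨fun v e => ?_, fun v => ?_, fun e => ?_⟩
    · simpa using (h1 (σ.1⁻¹ v) (σ.2⁻¹ e)).symm
    · simpa using (h2 (σ.1⁻¹ v)).symm
    · simpa using (h3 (σ.2⁻¹ e)).symm

section Quotient

variable (G : Type*) [Group G] [MulAction G V] [MulAction G E]

/-- `G` acts on the hypergraph `Y`: it acts on the vertices and on the edges and it preserves
incidence. -/
def Acts (Y : FinHypergraph V E) : Prop :=
  ∀ (g : G) (v : V) (e : E), v ∈ Y.edge e → g • v ∈ Y.edge (g • e)

/-- The action of `G` on the hypergraph `Y` is free. -/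
structure ActsFreely (Y : FinHypergraph V E) : Prop where
  acts : Acts G Y
  free_vertices : ∀ g : G, g ≠ 1 → ∀ v : V, g • v ≠ v
  free_edges : ∀ g : G, g ≠ 1 → ∀ e : E, g • e ≠ e
  not_mem : ∀ (v : V) (e : E), v ∈ Y.edge e → ∀ g : G, g ≠ 1 → g • v ∉ Y.edge e

/-- The set `{[v] | v ∈ e}` of vertex orbits depends only on the orbit of the edge `e`. -/
theorem image_edge_eq {Y : FinHypergraph V E} (h : Acts G Y) (e f : E)
    (hef : MulAction.orbitRel G E e f) :
    (Quotient.mk (MulAction.orbitRel G V)) '' Y.edge e =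
      (Quotient.mk (MulAction.orbitRel G V)) '' Y.edge f := by
  have key : ∀ e f : E, MulAction.orbitRel G E e f →
      (Quotient.mk (MulAction.orbitRel G V)) '' Y.edge e ⊆
        (Quotient.mk (MulAction.orbitRel G V)) '' Y.edge f := by
    rintro e f hef _ ⟨v, hv, rfl⟩
    obtain ⟨g, rfl⟩ := (MulAction.orbitRel G E).symm hef
    exact ⟨g • v, h g v e hv, Quotient.sound ⟨g, rfl⟩⟩
  exact (key e f hef).antisymm (key f e ((MulAction.orbitRel G E).symm hef))

/-- The quotient hypergraph `Y / G`: its vertices and edges are the orbits, and the edge `[e]` is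
the set `{[v] | v ∈ e}`. -/
def quotient (Y : FinHypergraph V E) (h : Acts G Y) :
    FinHypergraph (MulAction.orbitRel.Quotient G V) (MulAction.orbitRel.Quotient G E) where
  finite_vertices := haveI := Y.finite_vertices; Quotient.finite _
  finite_edges := haveI := Y.finite_edges; Quotient.finite _
  nonempty_vertices := Y.nonempty_vertices.map (Quotient.mk _)
  nonempty_edges := Y.nonempty_edges.map (Quotient.mk _)
  edge := Quotient.lift (fun e => (Quotient.mk (MulAction.orbitRel G V)) '' Y.edge e)
    (image_edge_eq G h)
  edge_nonempty := by
    rintro ⟨e⟩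
    exact (Y.edge_nonempty e).image _
  cover := by
    refine Set.eq_univ_of_forall ?_
    rintro ⟨v⟩
    have hv : v ∈ ⋃ e, Y.edge e := Y.cover ▸ Set.mem_univ v
    obtain ⟨e, he⟩ := Set.mem_iUnion.mp hv
    exact Set.mem_iUnion.mpr ⟨Quotient.mk _ e, v, he, rfl⟩

/-- `π : Y → X` is a free Galois covering with the Galois group `G`: the group `G` acts freely on
`Y`, the morphism `π` is the projection `Y → Y / G` up to an isomorphism `Y / G ≅ X`, and `G` is
isomorphic to the group of the automorphisms `σ` of `Y` with `π ∘ σ = π`. -/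
structure IsFreeGaloisCovering {Y : FinHypergraph V E} {X : FinHypergraph V' E'} (π : Hom Y X) :
    Prop where
  free : ActsFreely G Y
  projection : ∃ ψ : Iso (quotient G Y free.acts) X,
    (∀ v, ψ.onV (Quotient.mk _ v) = π.onV v) ∧ (∀ e, ψ.onE (Quotient.mk _ e) = π.onE e)
  galois : Nonempty (G ≃* deckGroup π)

end Quotient

/-! A path `(v₀, e₁, v₁, …, eₙ, vₙ)` is encoded by its initial vertex `v₀` together with the list
`[(e₁, v₁), …, (eₙ, vₙ)]`, whose length is the length `n` of the path. -/

/-- The sequence starting at `v` with the given steps is a path of `H`. -/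
def IsPath (H : FinHypergraph V E) : V → List (E × V) → Prop
  | _, [] => True
  | v, (e, w) :: s => v ∈ H.edge e ∧ w ∈ H.edge e ∧ IsPath H w s

/-- The terminal vertex of a path. -/
def terminal : V → List (E × V) → V
  | v, [] => v
  | _, (_, w) :: s => terminal w s

/-- `H` is connected: any two vertices are joined by a path. -/
def Connected (H : FinHypergraph V E) : Prop :=
  ∀ v w : V, ∃ s, H.IsPath v s ∧ terminal v s = w

/-- A cycle: a path of length at least two with the same initial and terminal vertex. -/
def IsCycle (H : FinHypergraph V E) (v : V) (s : List (E × V)) : Prop :=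
  H.IsPath v s ∧ 1 < s.length ∧ terminal v s = v

/-- The path contains a subsequence `(e, v, e)` of consecutive terms. -/
def HasEdgeBacktracking (s : List (E × V)) : Prop :=
  ∃ (e : E) (v w : V), [(e, v), (e, w)] <:+: s

/-- The path contains a subsequence `(v, e, v)` of consecutive terms. -/
def HasVertexRepetition : V → List (E × V) → Prop
  | _, [] => False
  | v, (_, w) :: s => v = w ∨ HasVertexRepetition w s

/-- The steps of the cycle obtained by going `m` times around a cycle. -/
def powSteps (s : List (E × V)) (m : ℕ) : List (E × V) :=
  (List.replicate m s).flatten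

/-- Prime cycles: cycles without edge-backtracking, without tail (the square has no
edge-backtracking), which are not proper powers of cycles.  There are two conventions on whether
a path may contain `(v, e, v)`; it may if `proper` is false, and it may not if `proper` is true. -/
structure IsPrimeCycle (proper : Prop) (H : FinHypergraph V E) (v : V) (s : List (E × V)) :
    Prop where
  isCycle : H.IsCycle v s
  not_repetition : proper → ¬ HasVertexRepetition v s
  not_backtracking : ¬ HasEdgeBacktracking s
  tailless : ¬ HasEdgeBacktracking (powSteps s 2)
  not_power : ∀ (w : V) (t : List (E × V)) (m : ℕ), H.IsCycle w t → 1 < m →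
    ¬ (v = w ∧ s = powSteps t m)

/-- The type of prime cycles of `H`. -/
def PrimeCycle (proper : Prop) (H : FinHypergraph V E) : Type _ :=
  {p : V × List (E × V) // IsPrimeCycle proper H p.1 p.2}

/-- Two prime cycles are equivalent if they differ by the choice of the initial vertex on the
cycle.  (The initial vertex of a cycle is the vertex in its last step.) -/
def primeSetoid (proper : Prop) (H : FinHypergraph V E) : Setoid (PrimeCycle proper H) where
  r C D := C.1.2 ~r D.1.2
  iseqv := ⟨fun _ => List.IsRotated.refl _, fun h => h.symm, fun h h' => h.trans h'⟩

/-- The equivalence classes `[C]` of prime cycles of `H`. -/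
def PrimeClass (proper : Prop) (H : FinHypergraph V E) : Type _ :=
  Quotient (primeSetoid proper H)

/-- The length of an equivalence class of prime cycles. -/
def PrimeClass.length {proper : Prop} {H : FinHypergraph V E} (c : PrimeClass proper H) : ℕ :=
  Quotient.lift (s := primeSetoid proper H) (fun C => C.1.2.length)
    (fun _ _ h => List.IsRotated.perm h |>.length_eq) c

/-- The factor `(1 - u ^ ℓ(C))⁻¹` of the Ihara zeta function. -/
noncomputable def zetaFactor {proper : Prop} (H : FinHypergraph V E) {R : Type*} [CommRing R]
    (u : R) (c : PrimeClass proper H) : R :=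
  Ring.inverse (1 - u ^ c.length)

/-- The Ihara zeta function `ζ_H(u) = ∏_{[C]} (1 - u ^ ℓ(C))⁻¹`; here `u` is an element of a
topological ring, such as the variable of a power series ring, or a complex number. -/
noncomputable def zeta (proper : Prop) (H : FinHypergraph V E) {R : Type*} [CommRing R]
    [TopologicalSpace R] (u : R) : R :=
  ∏' c : PrimeClass proper H, zetaFactor H u c

/-- The bipartite graph associated with a hypergraph. -/
def bipartite (H : FinHypergraph V E) : SimpleGraph (V ⊕ E) where
  Adj
    | .inl v, .inr e => v ∈ H.edge e
    | .inr e, .inl v => v ∈ H.edge e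
    | _, _ => False
  symm := ⟨by rintro (v | e) (w | f) h <;> exact h⟩
  loopless := ⟨by rintro (v | e) h <;> exact h⟩

/-- The sequence of the vertices of the bipartite graph which corresponds to a path. -/
def bipartiteSupport (v : V) (s : List (E × V)) : List (V ⊕ E) :=
  .inl v :: s.flatMap fun p => [.inr p.1, .inl p.2]

/-- The path of `Y` with initial vertex `v'` and steps `s'` is a lift along `π` of the path of `X`
with initial vertex `v` and steps `s`. -/
def IsLift {Y : FinHypergraph V E} {X : FinHypergraph V' E'} (π : Hom Y X)
    (v' : V) (s' : List (E × V)) (v : V') (s : List (E' × V')) : Prop :=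
  Y.IsPath v' s' ∧ π.onV v' = v ∧ s'.map (Prod.map π.onE π.onV) = s

/-- The choices on which sheet numbers depend: a spanning tree `T` of the bipartite graph of `X`,
a vertex `v₀` of `X`, and a vertex `v₀'` of `Y` above it. -/
structure SheetData {Y : FinHypergraph V E} {X : FinHypergraph V' E'} (π : Hom Y X) where
  tree : SimpleGraph (V' ⊕ E')
  tree_le : tree ≤ X.bipartite
  isTree : tree.IsTree
  base : V'
  baseLift : V
  onV_baseLift : π.onV baseLift = base

section Frobenius

variable {Y : FinHypergraph V E} {X : FinHypergraph V' E'} {π : Hom Y X}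

/-- The identity sheet: the terminal vertices of the lifts with initial vertex `v₀'` of the paths
of `X` with initial vertex `v₀` which correspond to paths in the tree `T`. -/
def SheetData.identitySheet (D : SheetData π) : Set V :=
  {w | ∃ (s : List (E' × V')) (s' : List (E × V)),
    (∃ (v : V') (q : D.tree.Walk (.inl D.base) (.inl v)),
      q.IsPath ∧ q.support = bipartiteSupport D.base s) ∧
    IsLift π D.baseLift s' D.base s ∧ terminal D.baseLift s' = w}

variable {G : Type*} [Group G] [MulAction G V]

/-- `g` is a sheet number of the vertex `v` of `Y`. -/
def SheetData.IsSheetNumber (D : SheetData π) (v : V) (g : G) : Prop :=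
  ∃ w ∈ D.identitySheet, g • w = v

/-- `g` is the sheet number of the terminal vertex of the lift of the path `(v, s)` of `X` whose
initial vertex has sheet number `1`. -/
def SheetData.IsFrobenius (D : SheetData π) (v : V') (s : List (E' × V')) (g : G) : Prop :=
  ∃ (v' : V) (s' : List (E × V)), IsLift π v' s' v s ∧
    D.IsSheetNumber v' (1 : G) ∧ D.IsSheetNumber (terminal v' s') g

/-- The Frobenius element `F(C, Y/X)`: the element `g` with `IsFrobenius`. -/
noncomputable def SheetData.frobenius (G : Type*) [Group G] [MulAction G V] {proper : Prop}
    (D : SheetData π) (C : PrimeCycle proper X) : G :=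
  Classical.epsilon fun g => D.IsFrobenius C.1.1 C.1.2 g

/-- The factor `det (1 - ρ(F(C, Y/X)) u ^ ℓ(C))⁻¹` of the Artin-Ihara `L`-function at the class
`c = [C]`, for the representative `C = rep c`; the scalars of `ρ` are extended to the ring `R` that
contains `u`. -/
noncomputable def lFactor {proper : Prop} (D : SheetData π)
    (rep : (c : PrimeClass proper X) → {C : PrimeCycle proper X // Quotient.mk _ C = c})
    {k W : Type*} [Field k] [AddCommGroup W] [Module k W] (ρ : Representation k G W)
    {R : Type*} [CommRing R] [Algebra k R] (u : R) (c : PrimeClass proper X) : R :=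
  Ring.inverse (LinearMap.det
    (LinearMap.id - u ^ c.length • (ρ (D.frobenius G (rep c).1)).baseChange R))

/-- The Artin-Ihara `L`-function
`L(u, ρ, Y/X) = ∏_{[C]} det (1 - ρ(F(C, Y/X)) u ^ ℓ(C))⁻¹`. -/
noncomputable def lFunction {proper : Prop} (D : SheetData π)
    (rep : (c : PrimeClass proper X) → {C : PrimeCycle proper X // Quotient.mk _ C = c})
    {k W : Type*} [Field k] [AddCommGroup W] [Module k W] (ρ : Representation k G W)
    {R : Type*} [CommRing R] [Algebra k R] [TopologicalSpace R] (u : R) : R :=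
  ∏' c : PrimeClass proper X, lFactor D rep ρ u c

end Frobenius

/-- The right regular representation of `G` on the functions on `G`: `(ρ(g) f)(x) = f(x g)`. -/
def rightRegular (k G : Type*) [Field k] [Group G] : Representation k G (G → k) where
  toFun g := LinearMap.funLeft k k (fun x => x * g)
  map_one' := by ext; simp [LinearMap.funLeft]
  map_mul' g h := by ext; simp [LinearMap.funLeft, mul_assoc]

end FinHypergraph

namespace FinHypergraph

variable {V E V' E' : Type*}

/-! ### Powers of words -/

section Words

/-! The prime cycles of `Y` are sorted by the prime cycle of `X` below them. Let C be prime in `X`,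
with Frobenius element F of order f, and let K be a lift of C from w to Fw. For g in G the
translates gK, gFK, …, gF^(f-1)K join up to a closed path above C^f, and it is prime
(`isPrimeCycle_orbitSteps`). Replacing g by gF only rotates it, so the classes above [C] correspond
to the left cosets of ⟨F⟩: there are [G : ⟨F⟩] of them, each of length f·ℓ(C)
(`exists_primeClass_lifts`). Conversely, the projection of a prime cycle of `Y` is a power of a
unique primitive word, and this root is a prime cycle of `X` (`exists_equiv_primeClass`).

On the other side, right multiplication by F splits G into [G : ⟨F⟩] cycles of length f, so det(1 -
t ρ_G(F)) = (1 - t^f)^[G : ⟨F⟩] (`det_one_sub_smul_rightRegular`). With t = u^ℓ(C), the factor of L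
at [C] is the product of the zeta factors of `Y` over the classes above [C]. Regrouping the
convergent zeta product gives the theorem.

Two tools support this: combinatorics of words (commuting words have a common root, so primitive
roots are unique) and unique path lifting, which follows from freeness. Convergence comes from
counting words over the finite alphabet `E × V`. -/

@[simp]
theorem powSteps_zero (s : List (E × V)) : powSteps s 0 = [] := rfl

theorem powSteps_succ (s : List (E × V)) (m : ℕ) : powSteps s (m + 1) = s ++ powSteps s m := rfl

@[simp]
theorem powSteps_one (s : List (E × V)) : powSteps s 1 = s := by simp [powSteps_succ]

@[simp]
theorem powSteps_nil (m : ℕ) : powSteps ([] : List (E × V)) m = [] := by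
  induction m with
  | zero => rfl
  | succ m ih => rw [powSteps_succ, ih, List.append_nil]

theorem powSteps_add (s : List (E × V)) (m n : ℕ) :
    powSteps s (m + n) = powSteps s m ++ powSteps s n := by
  induction m with
  | zero => simp
  | succ m ih => rw [Nat.succ_add, powSteps_succ, ih, powSteps_succ, List.append_assoc]

theorem powSteps_mul (s : List (E × V)) (m n : ℕ) :
    powSteps s (m * n) = powSteps (powSteps s m) n := by
  induction n with
  | zero => rfl
  | succ n ih => rw [Nat.mul_succ, add_comm, powSteps_add, ih, powSteps_succ]

@[simp]
theorem length_powSteps (s : List (E × V)) (m : ℕ) : (powSteps s m).length = m * s.length := by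
  induction m with
  | zero => simp
  | succ m ih => rw [powSteps_succ, List.length_append, ih]; ring

theorem map_powSteps (φ : E × V → E' × V') (s : List (E × V)) (m : ℕ) :
    (powSteps s m).map φ = powSteps (s.map φ) m := by
  induction m with
  | zero => rfl
  | succ m ih => rw [powSteps_succ, List.map_append, ih, powSteps_succ]

theorem append_powSteps_comm (a b : List (E × V)) (m : ℕ) :
    a ++ powSteps (b ++ a) m = powSteps (a ++ b) m ++ a := by
  induction m with
  | zero => simp
  | succ m ih =>
    rw [powSteps_succ, powSteps_succ, List.append_assoc (a ++ b), ← ih]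
    simp

theorem append_comm_powSteps (s : List (E × V)) (m : ℕ) :
    s ++ powSteps s m = powSteps s m ++ s := by
  simpa using append_powSteps_comm s [] m

theorem rotate_one_powSteps (s : List (E × V)) (m : ℕ) :
    (powSteps s m).rotate 1 = powSteps (s.rotate 1) m := by
  cases s with
  | nil => simp
  | cons x y =>
    cases m with
    | zero => rfl
    | succ m =>
      rw [List.rotate_cons_succ, List.rotate_zero, powSteps_succ, List.cons_append,
        List.rotate_cons_succ, List.rotate_zero]
      have h := append_powSteps_comm y [x] m
      rw [List.singleton_append] at h
      rw [h, List.append_assoc, ← append_comm_powSteps, powSteps_succ]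

theorem rotate_powSteps (s : List (E × V)) (m i : ℕ) :
    (powSteps s m).rotate i = powSteps (s.rotate i) m := by
  induction i with
  | zero => simp
  | succ i ih => rw [← List.rotate_rotate, ih, rotate_one_powSteps, List.rotate_rotate]

/-- Commuting words are powers of the same word. -/
theorem exists_powSteps_of_append_comm (s t : List (E × V)) (h : s ++ t = t ++ s) :
    ∃ (z : List (E × V)) (j k : ℕ), s = powSteps z j ∧ t = powSteps z k := by
  induction hn : s.length + t.length using Nat.strong_induction_on generalizing s t with
  | _ n ih =>
  wlog hle : s.length ≤ t.length generalizing s t with H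
  · obtain ⟨z, j, k, hj, hk⟩ := H t s h.symm (by omega) (by omega)
    exact ⟨z, k, j, hk, hj⟩
  by_cases hs : s = []
  · exact ⟨t, 0, 1, by simp [hs], by simp⟩
  have hpos := List.length_pos_of_ne_nil hs
  -- Euclid's algorithm on lengths: both words are prefixes of st = ts, so the shorter is a prefix
  -- of the longer, and the remainder r still commutes with s.
  obtain ⟨r, rfl⟩ : s <+: t :=
    List.prefix_of_prefix_length_le (List.prefix_append s t) (h ▸ List.prefix_append t s) hle
  rw [List.append_assoc, List.append_cancel_left_eq] at h
  simp only [List.length_append] at hn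
  obtain ⟨z, j, k, hj, hk⟩ := ih (s.length + r.length) (by omega) s r h rfl
  exact ⟨z, j, j + k, hj, by rw [powSteps_add, ← hj, ← hk]⟩

/-- Two words with a common power are powers of the same word. -/
theorem exists_powSteps_of_powSteps_eq (s t : List (E × V)) {a b : ℕ} (ha : a ≠ 0) (hb : b ≠ 0)
    (h : powSteps s a = powSteps t b) :
    ∃ (z : List (E × V)) (j k : ℕ), s = powSteps z j ∧ t = powSteps z k := by
  apply exists_powSteps_of_append_comm
  set u := powSteps s a with hu
  have hsu : s ++ u = u ++ s := append_comm_powSteps s a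
  have htu : t ++ u = u ++ t := h ▸ append_comm_powSteps t b
  have hls : s.length ≤ u.length := by
    rw [hu, length_powSteps]; exact Nat.le_mul_of_pos_left _ (Nat.pos_of_ne_zero ha)
  have hlt : t.length ≤ u.length := by
    rw [h, length_powSteps]; exact Nat.le_mul_of_pos_left _ (Nat.pos_of_ne_zero hb)
  -- The common power u commutes with s and t, hence with their products. So st and ts are both
  -- prefixes of uu, and having equal length they coincide.
  have key : ∀ p q : List (E × V), p ++ u = u ++ p → q ++ u = u ++ q →
      p.length ≤ u.length → q.length ≤ u.length → p ++ q <+: u ++ u := by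
    intro p q hp hq hlp hlq
    have h1 : p ++ q <+: u ++ u ++ (p ++ q) := by
      refine ⟨u ++ u, ?_⟩
      calc p ++ q ++ (u ++ u) = p ++ (q ++ u) ++ u := by simp
        _ = (p ++ u) ++ (q ++ u) := by simp only [List.append_assoc, hq]
        _ = u ++ (p ++ u) ++ q := by
          rw [hq, hp]
          simp only [List.append_assoc]
          rw [← List.append_assoc p u q, hp, List.append_assoc]
        _ = _ := by rw [hp]; simp only [List.append_assoc]
    exact List.prefix_of_prefix_length_le h1 (List.prefix_append _ _) (by simp; omega)
  exact (List.prefix_of_prefix_length_le (key s t hsu htu hls hlt) (key t s htu hsu hlt hls)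
    (by simp; omega)).eq_of_length (by simp; omega)

/-- A word which is not a proper power. -/
def IsPrimitive (s : List (E × V)) : Prop := ∀ t m, s = powSteps t m → m = 1

theorem IsPrimitive.ne_nil {s : List (E × V)} (hs : IsPrimitive s) : s ≠ [] := by
  rintro rfl
  -- Exponent 0 is admitted in `IsPrimitive`, which excludes the empty word.
  simpa using hs [] 0 rfl

theorem IsPrimitive.rotate {s : List (E × V)} (hs : IsPrimitive s) (i : ℕ) :
    IsPrimitive (s.rotate i) := by
  intro t m h
  obtain ⟨j, hj⟩ : s.rotate i ~r s := (List.IsRotated.symm ⟨i, rfl⟩)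
  rw [h, rotate_powSteps] at hj
  exact hs _ _ hj.symm

/-- If a power of a word is a power of a primitive word, then so is the word itself. -/
theorem IsPrimitive.exists_eq_powSteps {s t : List (E × V)} (hs : IsPrimitive s) {a b : ℕ}
    (ha : a ≠ 0) (hb : b ≠ 0) (h : powSteps s a = powSteps t b) : ∃ k, t = powSteps s k := by
  obtain ⟨z, j, k, hj, hk⟩ := exists_powSteps_of_powSteps_eq s t ha hb h
  obtain rfl := hs z j hj
  rw [powSteps_one] at hj
  exact ⟨k, hj ▸ hk⟩

/-- Uniqueness of primitive roots; it makes the class of `X` below a prime cycle of `Y` unique. -/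
theorem IsPrimitive.eq_of_powSteps_eq {s t : List (E × V)} (hs : IsPrimitive s)
    (ht : IsPrimitive t) {a b : ℕ} (ha : a ≠ 0) (hb : b ≠ 0) (h : powSteps s a = powSteps t b) :
    s = t := by
  obtain ⟨k, hk⟩ := hs.exists_eq_powSteps ha hb h
  obtain rfl := ht _ _ hk
  rw [hk, powSteps_one]

/-- A rotation fixing s cuts it into two commuting factors, which are powers of one word with
exponents of sum 1; so one of them is empty. -/
theorem IsPrimitive.length_dvd_of_rotate_eq {s : List (E × V)} (hs : IsPrimitive s) {i : ℕ}
    (h : s.rotate i = s) : s.length ∣ i := by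
  rw [← List.rotate_mod] at h
  have hpos := List.length_pos_of_ne_nil hs.ne_nil
  have hlt := Nat.mod_lt i hpos
  rw [List.rotate_eq_drop_append_take hlt.le] at h
  obtain ⟨z, j, k, hj, hk⟩ := exists_powSteps_of_append_comm (s.drop (i % s.length))
    (s.take (i % s.length)) (by rw [h, List.take_append_drop])
  have h1 := hs z (j + k) (by rw [powSteps_add, ← hj, ← hk, h])
  rw [Nat.dvd_iff_mod_eq_zero]
  rcases Nat.eq_zero_or_pos j with rfl | hj0
  · have := congrArg List.length hj
    rw [List.length_drop, powSteps_zero, List.length_nil] at this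
    omega
  · obtain rfl : k = 0 := by omega
    have := congrArg List.length hk
    rw [List.length_take, powSteps_zero, List.length_nil] at this
    omega

/-- Every nonempty word is a power of a primitive word. -/
theorem exists_isPrimitive_powSteps (s : List (E × V)) (hs : s ≠ []) :
    ∃ z m, m ≠ 0 ∧ IsPrimitive z ∧ s = powSteps z m := by
  induction hn : s.length using Nat.strong_induction_on generalizing s with
  | _ n ih =>
  by_cases hp : IsPrimitive s
  · exact ⟨s, 1, one_ne_zero, hp, by simp⟩
  · obtain ⟨t, m, rfl, hm⟩ : ∃ t m, s = powSteps t m ∧ m ≠ 1 := by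
      simpa [IsPrimitive] using hp
    have ht : t ≠ [] := by rintro rfl; simp at hs
    have hm0 : m ≠ 0 := by rintro rfl; simp at hs
    have hpos := List.length_pos_of_ne_nil ht
    rw [length_powSteps] at hn
    have h2 : 2 ≤ m := by omega
    obtain ⟨z, k, hk, hz, rfl⟩ := ih t.length (by nlinarith) t ht rfl
    exact ⟨z, k * m, mul_ne_zero hk hm0, hz, (powSteps_mul z k m).symm⟩

end Words

/-! ### Paths -/

section Paths

variable {H : FinHypergraph V E}

theorem isPath_append {v : V} {s t : List (E × V)} :
    H.IsPath v (s ++ t) ↔ H.IsPath v s ∧ H.IsPath (terminal v s) t := by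
  induction s generalizing v with
  | nil => simp [IsPath, terminal]
  | cons a s ih => simp [IsPath, terminal, ih, and_assoc]

theorem terminal_append (v : V) (s t : List (E × V)) :
    terminal v (s ++ t) = terminal (terminal v s) t := by
  induction s generalizing v with
  | nil => rfl
  | cons a s ih => simpa [terminal] using ih a.2

theorem terminal_eq_terminal (v w : V) {s : List (E × V)} (hs : s ≠ []) :
    terminal v s = terminal w s := by
  cases s with
  | nil => exact absurd rfl hs
  | cons a s => rfl

theorem terminal_powSteps (v : V) (s : List (E × V)) {m : ℕ} (hm : m ≠ 0) :
    terminal v (powSteps s m) = terminal v s := by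
  obtain ⟨n, rfl⟩ := Nat.exists_eq_succ_of_ne_zero hm
  by_cases hs : s = []
  · simp [hs]
  · rw [Nat.succ_eq_add_one, powSteps_add, powSteps_one, terminal_append]
    exact terminal_eq_terminal _ _ hs

theorem IsPath.powSteps {v : V} {s : List (E × V)} (hs : H.IsPath v s) (ht : terminal v s = v)
    (m : ℕ) : H.IsPath v (powSteps s m) := by
  induction m with
  | zero => trivial
  | succ m ih => rw [powSteps_succ, isPath_append, ht]; exact ⟨hs, ih⟩

theorem IsPath.of_powSteps {v : V} {s : List (E × V)} {m : ℕ} (hm : m ≠ 0)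
    (h : H.IsPath v (FinHypergraph.powSteps s m)) : H.IsPath v s := by
  obtain ⟨n, rfl⟩ := Nat.exists_eq_succ_of_ne_zero hm
  rw [Nat.succ_eq_add_one, powSteps_succ, isPath_append] at h
  exact h.1

theorem IsPath.rotate {v : V} {s : List (E × V)} (hs : H.IsPath v s) (ht : terminal v s = v)
    (i : ℕ) : ∃ w, H.IsPath w (s.rotate i) ∧ terminal w (s.rotate i) = w := by
  induction i with
  | zero => exact ⟨v, by simpa using hs, by simpa using ht⟩
  | succ i ih =>
    obtain ⟨w, h1, h2⟩ := ih
    rw [← List.rotate_rotate]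
    generalize s.rotate i = t at h1 h2 ⊢
    cases t with
    | nil => exact ⟨w, h1, h2⟩
    | cons a t =>
      refine ⟨a.2, ?_⟩
      rw [← List.singleton_append, isPath_append] at h1
      rw [← List.singleton_append, terminal_append] at h2
      rw [List.rotate_cons_succ, List.rotate_zero, isPath_append, terminal_append]
      replace h2 : terminal a.2 t = w := h2
      rw [h2]
      exact ⟨⟨h1.2, h1.1⟩, rfl⟩

theorem hasVertexRepetition_append {v : V} {s t : List (E × V)} :
    HasVertexRepetition v (s ++ t) ↔
      HasVertexRepetition v s ∨ HasVertexRepetition (terminal v s) t := by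
  induction s generalizing v with
  | nil => simp [HasVertexRepetition, terminal]
  | cons a s ih => simp [HasVertexRepetition, terminal, ih, or_assoc]

theorem hasVertexRepetition_powSteps {v : V} {s : List (E × V)} (ht : terminal v s = v) {m : ℕ}
    (hm : m ≠ 0) : HasVertexRepetition v (powSteps s m) ↔ HasVertexRepetition v s := by
  induction m with
  | zero => exact absurd rfl hm
  | succ m ih =>
    rw [powSteps_succ, hasVertexRepetition_append, ht]
    by_cases h0 : m = 0
    · simp [h0, HasVertexRepetition]
    · rw [ih h0, or_self]

theorem HasEdgeBacktracking.of_infix {s t : List (E × V)} (h : HasEdgeBacktracking s)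
    (hst : s <:+: t) : HasEdgeBacktracking t := by
  obtain ⟨e, v, w, h⟩ := h
  exact ⟨e, v, w, h.trans hst⟩

theorem HasEdgeBacktracking.map {s : List (E × V)} (h : HasEdgeBacktracking s) (f : E → E')
    (g : V → V') : HasEdgeBacktracking (s.map (Prod.map f g)) := by
  obtain ⟨e, v, w, h⟩ := h
  exact ⟨f e, g v, g w, h.map (Prod.map f g)⟩

theorem powSteps_prefix (s : List (E × V)) {m n : ℕ} (h : m ≤ n) :
    powSteps s m <+: powSteps s n := by
  obtain ⟨k, rfl⟩ := Nat.exists_eq_add_of_le h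
  rw [powSteps_add]
  exact List.prefix_append _ _

theorem hasEdgeBacktracking_cons_cons {a b : E × V} {s : List (E × V)} :
    HasEdgeBacktracking (a :: b :: s) ↔ a.1 = b.1 ∨ HasEdgeBacktracking (b :: s) := by
  constructor
  · rintro ⟨e, v, w, h⟩
    rw [List.infix_cons_iff] at h
    rcases h with h | h
    · left
      obtain ⟨t, ht⟩ := h
      simp only [List.cons_append, List.nil_append, List.cons.injEq] at ht
      rw [← ht.1, ← ht.2.1]
    · exact Or.inr ⟨e, v, w, h⟩
  · rintro (h | h)
    · obtain ⟨e, v⟩ := a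
      obtain ⟨f, w⟩ := b
      obtain rfl : e = f := h
      exact ⟨e, v, w, [], s, rfl⟩
    · exact h.of_infix (List.suffix_cons _ _).isInfix

/-- Backtracking concerns adjacent steps only, so its absence is a chain condition, which behaves
well under concatenation and maps. -/
theorem not_hasEdgeBacktracking_iff {s : List (E × V)} :
    ¬ HasEdgeBacktracking s ↔ s.IsChain (fun a b => a.1 ≠ b.1) := by
  induction s with
  | nil => simp [HasEdgeBacktracking]
  | cons a s ih =>
    cases s with
    | nil =>
      simp only [List.isChain_singleton, iff_true]
      rintro ⟨e, v, w, h⟩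
      simpa using h.length_le
    | cons b s => rw [hasEdgeBacktracking_cons_cons, List.isChain_cons_cons, ← ih]; tauto

/-- Every pair of adjacent steps of a power of s already occurs inside s or at the junction of two
copies, hence in the square. -/
theorem not_hasEdgeBacktracking_powSteps {s : List (E × V)}
    (h : ¬ HasEdgeBacktracking (powSteps s 2)) (m : ℕ) : ¬ HasEdgeBacktracking (powSteps s m) := by
  rw [not_hasEdgeBacktracking_iff] at h ⊢
  rw [powSteps_succ, powSteps_one, List.isChain_append] at h
  induction m with
  | zero => simp
  | succ m ih =>
    rw [powSteps_succ, List.isChain_append]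
    refine ⟨h.1, ih, ?_⟩
    intro x hx y hy
    refine h.2.2 x hx y ?_
    cases m with
    | zero => simp at hy
    | succ m =>
      cases s with
      | nil => simp at hx
      | cons a s => simpa [powSteps_succ] using hy

theorem hasEdgeBacktracking_powSteps_of_length_eq_one {s : List (E × V)} {m : ℕ} (hm : 1 < m)
    (h : s.length = 1) : HasEdgeBacktracking (powSteps s m) := by
  obtain ⟨⟨e, v⟩, rfl⟩ := List.length_eq_one_iff.mp h
  exact HasEdgeBacktracking.of_infix (s := powSteps [(e, v)] 2) ⟨e, v, v, List.infix_rfl⟩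
    (powSteps_prefix _ hm).isInfix

theorem IsPrimeCycle.ne_nil {proper : Prop} {v : V} {s : List (E × V)}
    (h : IsPrimeCycle proper H v s) : s ≠ [] :=
  List.ne_nil_of_length_pos (zero_lt_one.trans h.isCycle.2.1)

/-- Reduces primality to primitivity of the word of steps. The bound on lengths is automatic, for
the cycle and for its roots, because a proper power of a one-step path backtracks. -/
theorem isPrimeCycle_iff {proper : Prop} {v : V} {s : List (E × V)} :
    IsPrimeCycle proper H v s ↔ H.IsPath v s ∧ terminal v s = v ∧
      (proper → ¬ HasVertexRepetition v s) ∧ ¬ HasEdgeBacktracking (powSteps s 2) ∧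
      IsPrimitive s := by
  constructor
  · intro h
    refine ⟨h.isCycle.1, h.isCycle.2.2, h.not_repetition, h.tailless, ?_⟩
    rintro t m rfl
    have hm : m ≠ 0 := by rintro rfl; exact h.ne_nil rfl
    have ht : t ≠ [] := by rintro rfl; exact h.ne_nil (powSteps_nil m)
    by_contra hm1
    refine h.not_power v t m ⟨h.isCycle.1.of_powSteps hm, ?_, ?_⟩ (by omega) ⟨rfl, rfl⟩
    · have := List.length_pos_of_ne_nil ht
      by_contra hlt
      exact h.not_backtracking
        (hasEdgeBacktracking_powSteps_of_length_eq_one (by omega) (by omega))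
    · rw [← terminal_powSteps v t hm]; exact h.isCycle.2.2
  · rintro ⟨hp, ht, hr, hb, hs⟩
    refine ⟨⟨hp, ?_, ht⟩, hr, ?_, hb, ?_⟩
    · have := List.length_pos_of_ne_nil hs.ne_nil
      by_contra hlt
      exact hb (hasEdgeBacktracking_powSteps_of_length_eq_one (by omega) (by omega))
    · simpa using not_hasEdgeBacktracking_powSteps hb 1
    · rintro w t m - hm ⟨-, h⟩
      exact hm.ne' (hs t m h)

end Paths

/-! ### Free Galois coverings -/

section Covering

variable {Y : FinHypergraph V E} {X : FinHypergraph V' E'} {π : Hom Y X}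

section

variable {G : Type*} [Group G] [MulAction G V] [MulAction G E]

theorem IsFreeGaloisCovering.onV_eq_iff (hπ : IsFreeGaloisCovering G π) {v w : V} :
    π.onV v = π.onV w ↔ ∃ g : G, g • v = w := by
  obtain ⟨ψ, hV, -⟩ := hπ.projection
  rw [← hV, ← hV, ψ.onV.apply_eq_iff_eq, eq_comm, Quotient.eq]
  exact Iff.rfl

theorem IsFreeGaloisCovering.onE_eq_iff (hπ : IsFreeGaloisCovering G π) {e f : E} :
    π.onE e = π.onE f ↔ ∃ g : G, g • e = f := by
  obtain ⟨ψ, -, hE⟩ := hπ.projection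
  rw [← hE, ← hE, ψ.onE.apply_eq_iff_eq, eq_comm, Quotient.eq]
  exact Iff.rfl

theorem IsFreeGaloisCovering.onV_smul (hπ : IsFreeGaloisCovering G π) (g : G) (v : V) :
    π.onV (g • v) = π.onV v :=
  (hπ.onV_eq_iff.mpr ⟨g, rfl⟩).symm

theorem IsFreeGaloisCovering.onE_smul (hπ : IsFreeGaloisCovering G π) (g : G) (e : E) :
    π.onE (g • e) = π.onE e :=
  (hπ.onE_eq_iff.mpr ⟨g, rfl⟩).symm

theorem IsFreeGaloisCovering.onV_surjective (hπ : IsFreeGaloisCovering G π) :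
    Function.Surjective π.onV := by
  obtain ⟨ψ, hV, -⟩ := hπ.projection
  intro x
  obtain ⟨q, rfl⟩ := ψ.onV.surjective x
  obtain ⟨v, rfl⟩ := Quotient.exists_rep q
  exact ⟨v, (hV v).symm⟩

theorem IsFreeGaloisCovering.onE_surjective (hπ : IsFreeGaloisCovering G π) :
    Function.Surjective π.onE := by
  obtain ⟨ψ, -, hE⟩ := hπ.projection
  intro x
  obtain ⟨q, rfl⟩ := ψ.onE.surjective x
  obtain ⟨e, rfl⟩ := Quotient.exists_rep q
  exact ⟨e, (hE e).symm⟩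

/-- With the next three lemmas: π is bijective from the vertices of an edge, and from the edges at a
vertex, onto those of the image. Unique path lifting follows. -/
theorem IsFreeGaloisCovering.exists_mem_edge (hπ : IsFreeGaloisCovering G π) {x : V'} {e : E}
    (hx : x ∈ X.edge (π.onE e)) : ∃ v ∈ Y.edge e, π.onV v = x := by
  obtain ⟨ψ, hV, hE⟩ := hπ.projection
  obtain ⟨q, rfl⟩ := ψ.onV.surjective x
  rw [← hE, ψ.map_mem_iff] at hx
  obtain ⟨v, hv, rfl⟩ := hx
  exact ⟨v, hv, (hV v).symm⟩

theorem IsFreeGaloisCovering.exists_edge_mem (hπ : IsFreeGaloisCovering G π) {v : V} {y : E'}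
    (hv : π.onV v ∈ X.edge y) : ∃ e, v ∈ Y.edge e ∧ π.onE e = y := by
  obtain ⟨e, rfl⟩ := hπ.onE_surjective y
  obtain ⟨w, hw, hwv⟩ := hπ.exists_mem_edge hv
  obtain ⟨g, rfl⟩ := hπ.onV_eq_iff.mp hwv
  exact ⟨g • e, hπ.free.acts g w e hw, hπ.onE_smul g e⟩

theorem IsFreeGaloisCovering.eq_of_mem_edge (hπ : IsFreeGaloisCovering G π) {v w : V} {e : E}
    (hv : v ∈ Y.edge e) (hw : w ∈ Y.edge e) (h : π.onV v = π.onV w) : v = w := by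
  obtain ⟨g, rfl⟩ := hπ.onV_eq_iff.mp h
  by_cases hg : g = 1
  · simp [hg]
  · exact absurd hw (hπ.free.not_mem v e hv g hg)

/-- If v lies in e and in ge, then v and g⁻¹v both lie in e, so freeness forces g = 1. -/
theorem IsFreeGaloisCovering.edge_eq_of_mem (hπ : IsFreeGaloisCovering G π) {v : V} {e f : E}
    (he : v ∈ Y.edge e) (hf : v ∈ Y.edge f) (h : π.onE e = π.onE f) : e = f := by
  obtain ⟨g, rfl⟩ := hπ.onE_eq_iff.mp h
  by_cases hg : g = 1
  · simp [hg]
  · have h1 := hπ.free.acts g⁻¹ v _ hf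
    rw [inv_smul_smul] at h1
    exact absurd h1 (hπ.free.not_mem v e he g⁻¹ (by simpa using hg))

theorem IsFreeGaloisCovering.smul_injective (hπ : IsFreeGaloisCovering G π) {g h : G} {v : V}
    (hgh : g • v = h • v) : g = h := by
  by_contra hne
  refine hπ.free.free_vertices (h⁻¹ * g) (fun h1 => hne ?_) v ?_
  · exact (inv_mul_eq_one.mp h1).symm
  · rw [mul_smul, hgh, inv_smul_smul]

/-- Lifts of paths exist. -/
theorem IsFreeGaloisCovering.exists_isLift (hπ : IsFreeGaloisCovering G π) {v : V}
    {s : List (E' × V')} (hs : X.IsPath (π.onV v) s) : ∃ s', IsLift π v s' (π.onV v) s := by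
  induction s generalizing v with
  | nil => exact ⟨[], trivial, rfl, rfl⟩
  | cons a s ih =>
    obtain ⟨y, x⟩ := a
    obtain ⟨hv, hx, hs⟩ := hs
    obtain ⟨e, hve, rfl⟩ := hπ.exists_edge_mem hv
    obtain ⟨w, hwe, rfl⟩ := hπ.exists_mem_edge hx
    obtain ⟨s', h1, -, h3⟩ := ih hs
    exact ⟨(e, w) :: s', ⟨hve, hwe, h1⟩, rfl, by simp [h3]⟩

/-- Lifts of paths are determined by their initial vertices. -/
theorem IsFreeGaloisCovering.lift_unique (hπ : IsFreeGaloisCovering G π) {v : V}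
    {s t : List (E × V)} (hs : Y.IsPath v s) (ht : Y.IsPath v t)
    (h : s.map (Prod.map π.onE π.onV) = t.map (Prod.map π.onE π.onV)) : s = t := by
  induction s generalizing v t with
  | nil => exact (List.map_eq_nil_iff.mp h.symm).symm
  | cons a s ih =>
    cases t with
    | nil => simp at h
    | cons b t =>
      obtain ⟨e, w⟩ := a
      obtain ⟨f, w'⟩ := b
      obtain ⟨hv, hw, hs⟩ := hs
      obtain ⟨hv', hw', ht⟩ := ht
      simp only [List.map_cons, List.cons.injEq, Prod.map_apply, Prod.mk.injEq] at h
      obtain ⟨⟨h1, h2⟩, h3⟩ := h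
      obtain rfl := hπ.edge_eq_of_mem hv hv' h1
      obtain rfl := hπ.eq_of_mem_edge hw hw' h2
      rw [ih hs ht h3]

end

theorem IsPath.map {v : V} {s : List (E × V)} (hs : Y.IsPath v s) (π : Hom Y X) :
    X.IsPath (π.onV v) (s.map (Prod.map π.onE π.onV)) := by
  induction s generalizing v with
  | nil => trivial
  | cons a s ih => exact ⟨π.map_mem _ _ hs.1, π.map_mem _ _ hs.2.1, ih hs.2.2⟩

theorem terminal_map (v : V) (s : List (E × V)) (f : E → E') (g : V → V') :
    terminal (g v) (s.map (Prod.map f g)) = g (terminal v s) := by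
  induction s generalizing v with
  | nil => rfl
  | cons a s ih => exact ih a.2

theorem HasVertexRepetition.map {v : V} {s : List (E × V)} (h : HasVertexRepetition v s)
    (f : E → E') (g : V → V') : HasVertexRepetition (g v) (s.map (Prod.map f g)) := by
  induction s generalizing v with
  | nil => exact h
  | cons a s ih =>
    rcases h with h | h
    · exact Or.inl (congrArg g h)
    · exact Or.inr (ih h)

section

variable {G : Type*} [Group G] [MulAction G V] [MulAction G E]

/-- Consecutive vertices of a path share an edge, on which π is injective. -/
theorem IsFreeGaloisCovering.hasVertexRepetition_of_map (hπ : IsFreeGaloisCovering G π) {v : V}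
    {s : List (E × V)} (hs : Y.IsPath v s)
    (h : HasVertexRepetition (π.onV v) (s.map (Prod.map π.onE π.onV))) :
    HasVertexRepetition v s := by
  induction s generalizing v with
  | nil => exact h
  | cons a s ih =>
    rcases h with h | h
    · exact Or.inl (hπ.eq_of_mem_edge hs.1 hs.2.1 h)
    · exact Or.inr (ih hs.2.2 h)

/-- Consecutive edges of a path share a vertex, and π separates the edges at a vertex. -/
theorem IsFreeGaloisCovering.hasEdgeBacktracking_of_map (hπ : IsFreeGaloisCovering G π) {v : V}
    {s : List (E × V)} (hs : Y.IsPath v s)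
    (h : HasEdgeBacktracking (s.map (Prod.map π.onE π.onV))) : HasEdgeBacktracking s := by
  contrapose! h
  rw [not_hasEdgeBacktracking_iff] at h ⊢
  rw [List.isChain_map]
  induction s generalizing v with
  | nil => simp
  | cons a s ih =>
    cases s with
    | nil => simp
    | cons b s =>
      rw [List.isChain_cons_cons] at h ⊢
      refine ⟨fun hab => h.1 ?_, ih hs.2.2 h.2⟩
      exact hπ.edge_eq_of_mem hs.2.1 hs.2.2.1 hab

end

end Covering

/-! ### Sheets and Frobenius elements -/

section Sheets

variable {Y : FinHypergraph V E} {X : FinHypergraph V' E'} {π : Hom Y X}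

theorem Connected.of_surjective (hY : Y.Connected) (h : Function.Surjective π.onV) :
    X.Connected := by
  intro x y
  obtain ⟨v, rfl⟩ := h x
  obtain ⟨w, rfl⟩ := h y
  obtain ⟨s, hs, rfl⟩ := hY v w
  exact ⟨_, hs.map π, terminal_map _ _ _ _⟩

theorem IsPath.reachable_bipartite {v : V} {s : List (E × V)} (hs : Y.IsPath v s) :
    Y.bipartite.Reachable (.inl v) (.inl (terminal v s)) := by
  induction s generalizing v with
  | nil => exact SimpleGraph.Reachable.refl _
  | cons a s ih =>
    have h1 : Y.bipartite.Adj (.inl v) (.inr a.1) := hs.1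
    have h2 : Y.bipartite.Adj (.inr a.1) (.inl a.2) := hs.2.1
    exact (h1.reachable.trans h2.reachable).trans (ih hs.2.2)

theorem Connected.bipartite (hY : Y.Connected) : Y.bipartite.Connected := by
  obtain ⟨v⟩ := Y.nonempty_vertices
  have key : ∀ a, Y.bipartite.Reachable (.inl v) a := by
    rintro (w | e)
    · obtain ⟨s, hs, rfl⟩ := hY v w
      exact hs.reachable_bipartite
    · obtain ⟨w, hw⟩ := Y.edge_nonempty e
      have h1 : Y.bipartite.Adj (.inl w) (.inr e) := hw
      obtain ⟨s, hs, rfl⟩ := hY v w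
      exact hs.reachable_bipartite.trans h1.reachable
  exact { preconnected := fun a b => (key a).symm.trans (key b), nonempty := ⟨.inl v⟩ }

theorem nonempty_sheetData (hY : Y.Connected) (h : Function.Surjective π.onV) :
    Nonempty (SheetData π) := by
  have := X.finite_vertices
  have := X.finite_edges
  obtain ⟨T, hT, hT'⟩ := (hY.of_surjective h).bipartite.exists_isTree_le
  obtain ⟨v⟩ := Y.nonempty_vertices
  exact ⟨⟨T, hT, hT', π.onV v, v, rfl⟩⟩

theorem bipartiteSupport_cons (v : V) (a : E × V) (s : List (E × V)) :
    bipartiteSupport v (a :: s) = .inl v :: .inr a.1 :: bipartiteSupport a.2 s := rfl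

theorem bipartiteSupport_injective (v : V) :
    Function.Injective (bipartiteSupport v : List (E × V) → List (V ⊕ E)) := by
  intro s t h
  induction s generalizing v t with
  | nil =>
    cases t with
    | nil => rfl
    | cons b t => simp [bipartiteSupport] at h
  | cons a s ih =>
    cases t with
    | nil => simp [bipartiteSupport] at h
    | cons b t =>
      rw [bipartiteSupport_cons, bipartiteSupport_cons, List.cons.injEq, List.cons.injEq] at h
      obtain ⟨-, h1, h2⟩ := h
      have h3 : a.2 = b.2 := by simpa [bipartiteSupport] using congrArg List.head? h2
      rw [h3] at h2
      rw [Prod.ext (Sum.inr.inj h1) h3, ih _ h2]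

theorem getLast_bipartiteSupport (v : V) (s : List (E × V)) :
    (bipartiteSupport v s).getLast? = some (.inl (terminal v s)) := by
  induction s generalizing v with
  | nil => rfl
  | cons a s ih =>
    rw [bipartiteSupport_cons, List.getLast?_cons, List.getLast?_cons, ih]
    rfl

/-- A walk in a subgraph of the bipartite graph corresponds to a path of the hypergraph. -/
theorem exists_bipartiteSupport_eq {T : SimpleGraph (V ⊕ E)} (hT : T ≤ Y.bipartite)
    {a b : V ⊕ E} (q : T.Walk a b) {w : V} (hb : b = .inl w) :
    (∀ v, a = .inl v → ∃ s, Y.IsPath v s ∧ q.support = bipartiteSupport v s) ∧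
    (∀ e, a = .inr e → ∃ v s, v ∈ Y.edge e ∧ Y.IsPath v s ∧
      q.support = .inr e :: bipartiteSupport v s) := by
  -- Walks alternate between vertices and edges, so the claims for the two kinds of starting point
  -- feed each other.
  induction q with
  | nil =>
    subst hb
    refine ⟨?_, by simp⟩
    rintro v h
    exact ⟨[], trivial, by simp [bipartiteSupport, h]⟩
  | @cons a c b h q ih =>
    obtain ⟨ih1, ih2⟩ := ih hb
    have hac := hT h
    constructor
    · rintro v rfl
      cases c with
      | inl u => exact hac.elim
      | inr e =>
        obtain ⟨u, s, hu, hs, hq⟩ := ih2 e rfl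
        exact ⟨(e, u) :: s, ⟨hac, hu, hs⟩, by
          rw [SimpleGraph.Walk.support_cons, hq, bipartiteSupport_cons]⟩
    · rintro e rfl
      cases c with
      | inr f => exact hac.elim
      | inl u =>
        obtain ⟨s, hs, hq⟩ := ih1 u rfl
        exact ⟨u, s, hac, hs, by rw [SimpleGraph.Walk.support_cons, hq]⟩

theorem terminal_eq_of_support_eq {T : SimpleGraph (V ⊕ E)} {v w : V}
    (q : T.Walk (.inl v) (.inl w)) {s : List (E × V)} (h : q.support = bipartiteSupport v s) :
    terminal v s = w := by
  have h1 := getLast_bipartiteSupport v s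
  rw [← h, List.getLast?_eq_getLast_of_ne_nil q.support_ne_nil, q.getLast_support] at h1
  simpa [eq_comm] using h1

variable {G : Type*} [Group G] [MulAction G V] [MulAction G E]

/-- Every vertex of `X` has exactly one vertex of the identity sheet above it. -/
theorem SheetData.existsUnique_mem_identitySheet (hπ : IsFreeGaloisCovering G π)
    (D : SheetData π) (x : V') : ∃! w, w ∈ D.identitySheet ∧ π.onV w = x := by
  classical
  obtain ⟨q, hq⟩ := D.isTree.connected.exists_isPath (.inl D.base) (.inl x)
  obtain ⟨s, hs, hqs⟩ := (exists_bipartiteSupport_eq D.tree_le q rfl).1 D.base rfl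
  have hs' := hs
  rw [← D.onV_baseLift] at hs'
  obtain ⟨s', hs'⟩ := hπ.exists_isLift hs'
  rw [D.onV_baseLift] at hs'
  have hx := terminal_eq_of_support_eq q hqs
  refine ⟨terminal D.baseLift s', ⟨⟨s, s', ⟨x, q, hq, hqs⟩, hs', rfl⟩, ?_⟩, ?_⟩
  · rw [← terminal_map D.baseLift s' π.onE π.onV, hs'.2.1, hs'.2.2, hx]
  · rintro _ ⟨⟨t, t', ⟨y, p, hp, hpt⟩, ht', rfl⟩, hw⟩
    have hy := terminal_eq_of_support_eq p hpt
    rw [← terminal_map D.baseLift t' π.onE π.onV, ht'.2.1, ht'.2.2, hy] at hw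
    subst hw
    -- Simple paths of a tree with the same ends coincide; unique lifting then gives the same
    -- terminal vertex.
    have hpq := congrArg Subtype.val 
      ((D.isTree.isAcyclic.subsingleton_path _ _).elim ⟨p, hp⟩ ⟨q, hq⟩)
    simp only at hpq
    rw [hpq, hqs] at hpt
    obtain rfl := bipartiteSupport_injective _ hpt
    rw [hπ.lift_unique ht'.1 hs'.1 (ht'.2.2.trans hs'.2.2.symm)]

/-- Over a closed path both ends of the lift lie above the same vertex, so they are translates of
the same point of the identity sheet, namely the initial vertex. -/
theorem SheetData.isFrobenius_iff (hπ : IsFreeGaloisCovering G π) (D : SheetData π)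
    {v : V'} {s : List (E' × V')} (ht : terminal v s = v) {g : G} :
    D.IsFrobenius v s g ↔
      ∃ w s', w ∈ D.identitySheet ∧ IsLift π w s' v s ∧ terminal w s' = g • w := by
  constructor
  · rintro ⟨w, s', hs', ⟨_, hw, rfl⟩, ⟨w', hw', hwt⟩⟩
    rename_i w
    rw [one_smul] at hs' hwt
    refine ⟨w, s', hw, hs', ?_⟩
    have : w' = w := by
      refine (D.existsUnique_mem_identitySheet hπ v).unique ⟨hw', ?_⟩ ⟨hw, hs'.2.1⟩
      rw [← hπ.onV_smul g w', hwt, ← terminal_map w s' π.onE π.onV, hs'.2.1, hs'.2.2, ht]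
    rw [← hwt, this]
  · rintro ⟨w, s', hw, hs', hwt⟩
    exact ⟨w, s', hs', ⟨w, hw, one_smul _ _⟩, ⟨w, hw, hwt.symm⟩⟩

theorem SheetData.existsUnique_isFrobenius (hπ : IsFreeGaloisCovering G π) (D : SheetData π)
    {proper : Prop} (C : PrimeCycle proper X) : ∃! g : G, D.IsFrobenius C.1.1 C.1.2 g := by
  have ht := C.2.isCycle.2.2
  obtain ⟨w, ⟨hw, hwv⟩, huniq⟩ := D.existsUnique_mem_identitySheet hπ C.1.1
  have hs := C.2.isCycle.1
  rw [← hwv] at hs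
  obtain ⟨s', hs'⟩ := hπ.exists_isLift hs
  rw [hwv] at hs'
  obtain ⟨g, hg⟩ := (hπ.onV_eq_iff (v := w) (w := terminal w s')).mp (by
    rw [← terminal_map w s' π.onE π.onV, hs'.2.2, hwv, ht])
  refine ⟨g, (D.isFrobenius_iff hπ ht).mpr ⟨w, s', hw, hs', hg.symm⟩, ?_⟩
  intro h hh
  obtain ⟨w', t', hw', ht', hwt⟩ := (D.isFrobenius_iff hπ ht).mp hh
  obtain rfl := huniq w' ⟨hw', ht'.2.1⟩
  obtain rfl := hπ.lift_unique ht'.1 hs'.1 (ht'.2.2.trans hs'.2.2.symm)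
  exact hπ.smul_injective (hwt.symm.trans hg.symm)

/-- All that the sequel needs of the Frobenius element; the tree and the sheets do not enter again.
-/
theorem SheetData.frobenius_spec (hπ : IsFreeGaloisCovering G π) (D : SheetData π)
    {proper : Prop} (C : PrimeCycle proper X) :
    ∃ w s', IsLift π w s' C.1.1 C.1.2 ∧ terminal w s' = D.frobenius G C • w := by
  have h : D.IsFrobenius C.1.1 C.1.2 (D.frobenius G C) :=
    Classical.epsilon_spec (D.existsUnique_isFrobenius hπ C).exists
  obtain ⟨w, s', -, h⟩ := (D.isFrobenius_iff hπ C.2.isCycle.2.2).mp h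
  exact ⟨w, s', h⟩

end Sheets

/-! ### Prime cycles above a prime cycle -/

section Lifts

variable {G : Type*} [Group G] [MulAction G V] [MulAction G E]

/-- The concatenation of the translates of `K` by `g`, `g * F`, …, `g * F ^ (m - 1)`. -/
def orbitSteps (K : List (E × V)) (F : G) : G → ℕ → List (E × V)
  | _, 0 => []
  | g, m + 1 => K.map (Prod.map (g • ·) (g • ·)) ++ orbitSteps K F (g * F) m

theorem length_orbitSteps (K : List (E × V)) (F g : G) (m : ℕ) :
    (orbitSteps K F g m).length = m * K.length := by
  induction m generalizing g with
  | zero => simp [orbitSteps]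
  | succ m ih => rw [orbitSteps, List.length_append, ih, List.length_map]; ring

theorem orbitSteps_add (K : List (E × V)) (F g : G) (m n : ℕ) :
    orbitSteps K F g (m + n) = orbitSteps K F g m ++ orbitSteps K F (g * F ^ m) n := by
  induction m generalizing g with
  | zero => simp [orbitSteps]
  | succ m ih =>
    rw [Nat.succ_add, orbitSteps, ih, orbitSteps, List.append_assoc, pow_succ', mul_assoc]

theorem orbitSteps_mul (K : List (E × V)) {F : G} {m : ℕ} (hF : F ^ m = 1) (g : G) (n : ℕ) :
    orbitSteps K F g (m * n) = powSteps (orbitSteps K F g m) n := by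
  induction n with
  | zero => rfl
  | succ n ih => rw [Nat.mul_succ, add_comm, orbitSteps_add, hF, mul_one, ih, powSteps_succ]

/-- Since F^m = 1 the blocks are cyclically ordered, and moving the first to the end replaces g by
gF. Hence the class depends only on the left coset of g. -/
theorem rotate_orbitSteps (K : List (E × V)) {F : G} {m : ℕ} (hF : F ^ m = 1) (g : G) (j : ℕ) :
    (orbitSteps K F g m).rotate (K.length * j) = orbitSteps K F (g * F ^ j) m := by
  induction j with
  | zero => simp
  | succ j ih =>
    rw [Nat.mul_succ, ← List.rotate_rotate, ih, pow_succ, ← mul_assoc]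
    generalize g * F ^ j = h
    cases m with
    | zero => rfl
    | succ m =>
      have h1 : K.length = (K.map (Prod.map (h • ·) (h • ·))).length := by simp
      conv_lhs => rw [orbitSteps, h1, List.rotate_append_length_eq]
      have h2 : h * F * F ^ m = h := by rw [mul_assoc, ← pow_succ', hF, mul_one]
      rw [orbitSteps_add, h2]
      simp [orbitSteps]

/-- The block gK runs from gw to gFw, where the next block starts; this is why F multiplies on the
right. -/
theorem terminal_orbitSteps {K : List (E × V)} {F : G} {w : V} (hw : terminal w K = F • w) (g : G)
    (m : ℕ) : terminal (g • w) (orbitSteps K F g m) = (g * F ^ m) • w := by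
  induction m generalizing g with
  | zero => simp [orbitSteps, terminal]
  | succ m ih =>
    rw [orbitSteps, terminal_append, terminal_map w K (g • ·) (g • ·), hw, ← mul_smul, ih, mul_assoc,
      ← pow_succ']

variable {Y : FinHypergraph V E} {X : FinHypergraph V' E'} {π : Hom Y X}

theorem IsPath.smul (hY : Acts G Y) (g : G) {v : V} {s : List (E × V)} (hs : Y.IsPath v s) :
    Y.IsPath (g • v) (s.map (Prod.map (g • ·) (g • ·))) := by
  induction s generalizing v with
  | nil => trivial
  | cons a s ih => exact ⟨hY _ _ _ hs.1, hY _ _ _ hs.2.1, ih hs.2.2⟩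

theorem IsPath.orbitSteps (hY : Acts G Y) {K : List (E × V)} {F : G} {w : V} (hK : Y.IsPath w K)
    (hw : terminal w K = F • w) (g : G) (m : ℕ) :
    Y.IsPath (g • w) (FinHypergraph.orbitSteps K F g m) := by
  induction m generalizing g with
  | zero => trivial
  | succ m ih =>
    rw [FinHypergraph.orbitSteps, isPath_append, terminal_map w K (g • ·) (g • ·), hw, ← mul_smul]
    exact ⟨hK.smul hY g, ih _⟩

theorem IsFreeGaloisCovering.map_orbitSteps (hπ : IsFreeGaloisCovering G π) (K : List (E × V))
    (F g : G) (m : ℕ) : (orbitSteps K F g m).map (Prod.map π.onE π.onV) =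
      powSteps (K.map (Prod.map π.onE π.onV)) m := by
  induction m generalizing g with
  | zero => rfl
  | succ m ih =>
    rw [orbitSteps, List.map_append, ih, powSteps_succ, List.map_map]
    congr 2
    ext p
    · exact hπ.onE_smul g p.1
    · exact hπ.onV_smul g p.2

theorem IsFreeGaloisCovering.finite (hπ : IsFreeGaloisCovering G π) : Finite G := by
  have := Y.finite_vertices
  obtain ⟨v⟩ := Y.nonempty_vertices
  exact Finite.of_injective (fun g : G => g • v) fun _ _ h => hπ.smul_injective h

variable {proper : Prop}

/-- The projection is C^f with f the order of F, so any defect would show in C. If the cycle were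
t^m, primitivity of C would make t the lift of some C^j; as t is closed, F^j = 1, so f divides j,
while mj = f. Hence m = 1. -/
theorem IsFreeGaloisCovering.isPrimeCycle_orbitSteps (hπ : IsFreeGaloisCovering G π)
    {w : V} {K : List (E × V)} {v : V'} {s : List (E' × V')} {F : G}
    (hs : IsPrimeCycle proper X v s) (hK : IsLift π w K v s) (hw : terminal w K = F • w) (g : G) :
    IsPrimeCycle proper Y (g • w) (orbitSteps K F g (orderOf F)) := by
  have := hπ.finite
  have hf : orderOf F ≠ 0 := (orderOf_pos F).ne'
  obtain ⟨hKp, rfl, rfl⟩ := hK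
  obtain ⟨-, ht, hr, hb, hprim⟩ := isPrimeCycle_iff.mp hs
  have hpath := hKp.orbitSteps hπ.free.acts hw g (orderOf F)
  rw [isPrimeCycle_iff]
  refine ⟨hpath, ?_, fun hp h => ?_, fun h => ?_, ?_⟩
  · rw [terminal_orbitSteps hw, pow_orderOf_eq_one, mul_one]
  · refine hr hp ?_
    have := h.map π.onE π.onV
    rwa [hπ.map_orbitSteps, hπ.onV_smul, hasVertexRepetition_powSteps ht hf] at this
  · have := h.map π.onE π.onV
    rw [map_powSteps, hπ.map_orbitSteps, ← powSteps_mul] at this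
    exact not_hasEdgeBacktracking_powSteps hb _ this
  · intro t m h
    have hm : m ≠ 0 := by
      rintro rfl
      have := congrArg List.length h
      rw [length_orbitSteps] at this
      have hKn : K ≠ [] := fun h0 => hprim.ne_nil (by rw [h0]; rfl)
      have := List.length_pos_of_ne_nil hKn
      simp_all
    have h1 := congrArg (List.map (Prod.map π.onE π.onV)) h
    rw [hπ.map_orbitSteps, map_powSteps] at h1
    obtain ⟨j, hj⟩ := hprim.exists_eq_powSteps hf hm h1
    have htj : t = orbitSteps K F g j := by
      refine hπ.lift_unique ((h ▸ hpath).of_powSteps hm)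
        (hKp.orbitSteps hπ.free.acts hw g j) ?_
      rw [hj, hπ.map_orbitSteps]
    have h2 : terminal (g • w) (orbitSteps K F g (orderOf F)) = terminal (g • w) t := by
      rw [h, terminal_powSteps _ _ hm]
    rw [htj, terminal_orbitSteps hw, terminal_orbitSteps hw] at h2
    have h3 : F ^ j = 1 := by
      have := hπ.smul_injective h2
      rw [pow_orderOf_eq_one] at this
      exact (mul_left_cancel this).symm
    obtain ⟨k, hk⟩ := orderOf_dvd_of_pow_eq_one h3
    have h4 := congrArg List.length h
    rw [htj, length_powSteps, length_orbitSteps, length_orbitSteps, ← mul_assoc] at h4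
    have hKn : K ≠ [] := fun h0 => hprim.ne_nil (by rw [h0]; rfl)
    have h5 := Nat.eq_of_mul_eq_mul_right (List.length_pos_of_ne_nil hKn) h4
    rw [hk] at h5
    have h6 : m * k = 1 := Nat.eq_of_mul_eq_mul_left (Nat.pos_of_ne_zero hf) (by linarith)
    exact Nat.eq_one_of_mul_eq_one_right h6

/-- The classes of the prime cycles of `Y` above a prime cycle of `X` with Frobenius element `F`
correspond to the cosets of the subgroup generated by `F`. -/
theorem IsFreeGaloisCovering.exists_primeClass_lifts (hπ : IsFreeGaloisCovering G π)
    {w : V} {K : List (E × V)} {v : V'} {s : List (E' × V')} {F : G}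
    (hs : IsPrimeCycle proper X v s) (hK : IsLift π w K v s) (hw : terminal w K = F • w) :
    ∃ φ : G ⧸ Subgroup.zpowers F → PrimeClass proper Y, Function.Injective φ ∧
      (∀ q, ∃ D : PrimeCycle proper Y, φ q = Quotient.mk _ D ∧
        D.1.2.map (Prod.map π.onE π.onV) = powSteps s (orderOf F)) ∧
      ∀ x t m, Y.IsPath x t → terminal x t = x → IsPrimitive t →
        t.map (Prod.map π.onE π.onV) = powSteps s m →
        ∃ q, ∃ D : PrimeCycle proper Y, φ q = Quotient.mk _ D ∧ D.1.2 = t := by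
  have := hπ.finite
  have hf : orderOf F ≠ 0 := (orderOf_pos F).ne'
  have hF : F ^ orderOf F = 1 := pow_orderOf_eq_one F
  have hprim := (isPrimeCycle_iff.mp hs).2.2.2.2
  have hlen : K.length = s.length := by rw [← hK.2.2, List.length_map]
  have hKn : K ≠ [] := fun h0 => hprim.ne_nil (by rw [← hK.2.2, h0]; rfl)
  let lift : G → PrimeCycle proper Y := fun g =>
    ⟨(g • w, orbitSteps K F g (orderOf F)), hπ.isPrimeCycle_orbitSteps hs hK hw g⟩
  have hlift : ∀ g h, QuotientGroup.leftRel (Subgroup.zpowers F) g h →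
      (Quotient.mk (primeSetoid proper Y) (lift g) : PrimeClass proper Y) =
        Quotient.mk _ (lift h) := by
    intro g h hgh
    obtain ⟨j, hj⟩ := mem_powers_iff_mem_zpowers.mpr (QuotientGroup.leftRel_apply.mp hgh)
    replace hj : F ^ j = g⁻¹ * h := hj
    refine Quotient.sound ⟨K.length * j, ?_⟩
    change (orbitSteps K F g (orderOf F)).rotate _ = orbitSteps K F h (orderOf F)
    rw [rotate_orbitSteps K hF, hj, mul_inv_cancel_left]
  refine ⟨Quotient.lift _ hlift, ?_, ?_, ?_⟩
  · rintro ⟨g⟩ ⟨h⟩ hgh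
    obtain ⟨i, hi⟩ : orbitSteps K F g (orderOf F) ~r orbitSteps K F h (orderOf F) :=
      Quotient.exact hgh
    have h1 := congrArg (List.map (Prod.map π.onE π.onV)) hi
    rw [List.map_rotate, hπ.map_orbitSteps, hπ.map_orbitSteps, hK.2.2, rotate_powSteps] at h1
    -- The rotation fixes the primitive word s, so it shifts by whole blocks and multiplies g by a
    -- power of F. Comparing terminal vertices then recovers the group elements.
    have h2 := (hprim.rotate i).eq_of_powSteps_eq hprim hf hf h1
    obtain ⟨j, rfl⟩ := hprim.length_dvd_of_rotate_eq h2
    rw [← hlen, rotate_orbitSteps K hF] at hi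
    have h3 : terminal w (orbitSteps K F (g * F ^ j) (orderOf F)) =
        terminal w (orbitSteps K F h (orderOf F)) := by rw [hi]
    have hne : ∀ g, orbitSteps K F g (orderOf F) ≠ [] := by
      intro g h0
      have := congrArg List.length h0
      rw [length_orbitSteps] at this
      exact mul_ne_zero hf (List.length_pos_of_ne_nil hKn).ne' this
    rw [terminal_eq_terminal w ((g * F ^ j) • w) (hne _), terminal_eq_terminal w (h • w) (hne _),
      terminal_orbitSteps hw, terminal_orbitSteps hw, hF, mul_one, mul_one] at h3
    refine Quotient.sound (QuotientGroup.leftRel_apply.mpr ?_)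
    rw [← hπ.smul_injective h3, inv_mul_cancel_left]
    exact Subgroup.npow_mem_zpowers F j
  · rintro ⟨g⟩
    exact ⟨lift g, rfl, by rw [hπ.map_orbitSteps, hK.2.2]⟩
  · intro x t m hx hxt ht hm
    have hm0 : m ≠ 0 := by
      rintro rfl
      exact ht.ne_nil (by simpa using hm)
    have hsv := (isPrimeCycle_iff.mp hs).2.1
    obtain ⟨g, rfl⟩ : ∃ g : G, g • w = x := by
      rw [← hπ.onV_eq_iff, hK.2.1, ← hxt, ← terminal_map x t π.onE π.onV, hm,
        terminal_powSteps _ _ hm0, terminal_eq_terminal _ v hprim.ne_nil, hsv]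
    -- By unique lifting t is a run of m blocks; being closed it has F^m = 1, so it is a power of a
    -- full orbit, and primitivity leaves a single one.
    have htm : t = orbitSteps K F g m := by
      refine hπ.lift_unique hx (hK.1.orbitSteps hπ.free.acts hw g m) ?_
      rw [hm, hπ.map_orbitSteps, hK.2.2]
    have h1 : F ^ m = 1 := by
      rw [htm, terminal_orbitSteps hw] at hxt
      simpa using hπ.smul_injective hxt
    obtain ⟨k, rfl⟩ := orderOf_dvd_of_pow_eq_one h1
    rw [orbitSteps_mul K hF] at htm
    obtain rfl := ht _ _ htm
    rw [powSteps_one] at htm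
    exact ⟨Quotient.mk _ g, lift g, rfl, htm.symm⟩

/-- The classes of the prime cycles of `Y` are parametrised by the classes `c` of the prime cycles
of `X` and by the cosets of the subgroups generated by the Frobenius elements. -/
theorem SheetData.exists_equiv_primeClass (hπ : IsFreeGaloisCovering G π) (D : SheetData π)
    (rep : (c : PrimeClass proper X) → {C : PrimeCycle proper X // Quotient.mk _ C = c}) :
    ∃ e : (Σ c, G ⧸ Subgroup.zpowers (D.frobenius G (rep c).1)) ≃ PrimeClass proper Y,
      ∀ c q, (e ⟨c, q⟩).length = c.length * orderOf (D.frobenius G (rep c).1) := by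
  have := hπ.finite
  have key : ∀ c : PrimeClass proper X, _ := fun c =>
    let ⟨w, K, hK, hw⟩ := D.frobenius_spec hπ (G := G) (rep c).1
    hπ.exists_primeClass_lifts (rep c).1.2 hK hw
  choose φ hinj hmap hsurj using key
  have hprim : ∀ C : PrimeCycle proper X, IsPrimitive C.1.2 := fun C =>
    (isPrimeCycle_iff.mp C.2).2.2.2.2
  have hbij : Function.Bijective
      (fun p => φ p.1 p.2 : (Σ c, G ⧸ Subgroup.zpowers (D.frobenius G (rep c).1)) → _) := by
    constructor
    · rintro ⟨c, q⟩ ⟨c', q'⟩ h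
      -- Equal classes above have projections that are rotations of each other, so their primitive
      -- roots are too.
      have hc : c = c' := by
        obtain ⟨A, hA, hA'⟩ := hmap c q
        obtain ⟨B, hB, hB'⟩ := hmap c' q'
        have h' : φ c q = φ c' q' := h
        rw [hA, hB] at h'
        obtain ⟨i, hi⟩ : A.1.2 ~r B.1.2 := Quotient.exact h'
        have h1 := congrArg (List.map (Prod.map π.onE π.onV)) hi
        rw [List.map_rotate, hA', hB', rotate_powSteps] at h1
        have h2 := ((hprim _).rotate i).eq_of_powSteps_eq (hprim _) (orderOf_pos _).ne'
          (orderOf_pos _).ne' h1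
        rw [← (rep c).2, ← (rep c').2]
        exact Quotient.sound ⟨i, h2⟩
      subst hc
      exact congrArg (Sigma.mk c) (hinj c h)
    · intro d
      obtain ⟨⟨⟨v, s⟩, hd⟩, rfl⟩ := Quotient.exists_rep d
      obtain ⟨hs, hst, hr, hb, hp⟩ := isPrimeCycle_iff.mp hd
      dsimp only at hs hst hr hb hp
      -- The prime cycle below is the primitive root of the projection.
      obtain ⟨z, m, hm, hz, hsz⟩ := exists_isPrimitive_powSteps
        (s.map (Prod.map π.onE π.onV)) (by simpa using hp.ne_nil)
      have hzt : terminal (π.onV v) z = π.onV v := by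
        rw [← terminal_powSteps _ _ hm, ← hsz, terminal_map, hst]
      have hzprime : IsPrimeCycle proper X (π.onV v) z := by
        rw [isPrimeCycle_iff]
        have hpath := hs.map π
        refine ⟨?_, hzt, fun h h' => ?_, fun h => ?_, hz⟩
        · rw [hsz] at hpath
          exact hpath.of_powSteps hm
        · rw [← hasVertexRepetition_powSteps hzt hm, ← hsz] at h'
          exact hr h (hπ.hasVertexRepetition_of_map hs h')
        · refine hb (hπ.hasEdgeBacktracking_of_map (hs.powSteps hst 2) ?_)
          rw [map_powSteps, hsz, ← powSteps_mul]
          exact h.of_infix (powSteps_prefix z (by omega)).isInfix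
      let c : PrimeClass proper X := Quotient.mk _ ⟨(π.onV v, z), hzprime⟩
      -- The chosen representative is z rotated by some i; rotating s by the same i puts it above a
      -- power of that representative.
      obtain ⟨i, hi⟩ : z ~r (rep c).1.1.2 := (Quotient.exact (rep c).2.symm : _)
      obtain ⟨x, hx, hxt⟩ := hs.rotate hst i
      obtain ⟨q, A, hq, hA⟩ := hsurj c x (s.rotate i) m hx hxt (hp.rotate i) (by
        rw [List.map_rotate, hsz, rotate_powSteps, hi])
      refine ⟨⟨c, q⟩, hq.trans (Quotient.sound ?_)⟩
      change A.1.2 ~r s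
      rw [hA]
      exact List.IsRotated.symm ⟨i, rfl⟩
  refine ⟨Equiv.ofBijective _ hbij, fun c q => ?_⟩
  obtain ⟨A, hA, hA'⟩ := hmap c q
  have hA'' := congrArg List.length hA'
  rw [List.length_map, length_powSteps] at hA''
  have hc : c.length = (rep c).1.1.2.length := by
    conv_lhs => rw [← (rep c).2]
    rfl
  rw [Equiv.ofBijective_apply, hA, hc, mul_comm]
  exact hA''

end Lifts

/-! ### The determinant of the right regular representation -/

section Determinant

open Matrix

theorem one_sub_smul_permMatrix_apply {n R : Type*} [DecidableEq n] [CommRing R]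
    (σ : Equiv.Perm n) (t : R) (i j : n) : (1 - t • σ.permMatrix R) i j =
      (if i = j then 1 else 0) - t * (if σ i = j then 1 else 0) := by
  simp [Matrix.one_apply, PEquiv.toMatrix_apply, eq_comm]

/-- The characteristic determinant of a permutation which acts simply transitively by powers. -/
theorem det_one_sub_smul_permMatrix_of_isCycleOn {n R : Type*} [Fintype n] [DecidableEq n]
    [CommRing R] (σ : Equiv.Perm n) (hσ : σ.IsCycleOn Set.univ) [Nonempty n] (t : R) :
    (1 - t • σ.permMatrix R).det = 1 - t ^ Fintype.card n := by
  classical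
  -- On one point σ is the identity, which is not an `IsCycle`.
  by_cases hn : Subsingleton n
  · have hcard : Fintype.card n = 1 :=
      le_antisymm (Fintype.card_le_one_iff_subsingleton.mpr hn) Fintype.card_pos
    have hσ1 : σ = 1 := Subsingleton.elim _ _
    have : Unique n := Classical.choice (by
      obtain ⟨i⟩ := ‹Nonempty n›
      exact ⟨⟨⟨i⟩, fun _ => Subsingleton.elim _ _⟩⟩)
    subst hσ1
    rw [hcard, Matrix.det_unique]
    simp
  rw [not_subsingleton_iff_nontrivial] at hn
  have hne : ∀ i, σ i ≠ i := fun i =>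
    hσ.apply_ne ⟨i, Set.mem_univ _, (exists_ne i).choose, Set.mem_univ _,
      (exists_ne i).choose_spec.symm⟩ (Set.mem_univ i)
  have hsupp : σ.support = Finset.univ := by ext i; simp [hne]
  obtain ⟨x₀⟩ := ‹Nonempty n›
  have hcyc : σ.IsCycle := ⟨x₀, hne x₀, fun y _ => hσ.2 (Set.mem_univ _) (Set.mem_univ _)⟩
  rw [← Matrix.det_transpose, Matrix.det_apply']
  have hσ1 : (1 : Equiv.Perm n) ≠ σ := fun h => hne x₀ (by rw [← h]; rfl)
  have hentry : ∀ i j, (1 - t • σ.permMatrix R)ᵀ i j =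
      (if j = i then 1 else 0) - t * (if i = σ j then 1 else 0) := by
    intro i j
    rw [transpose_apply, one_sub_smul_permMatrix_apply]
    simp only [eq_comm]
  -- In the Leibniz expansion only permutations with τ i ∈ {i, σ i} for all i can contribute, and
  -- these are 1 and σ. The term of σ is -(-1)^n (-t)^n = -t^n.
  rw [← Finset.sum_subset (Finset.subset_univ {1, σ}), Finset.sum_pair hσ1]
  · have h1 : ∀ i, (1 - t • σ.permMatrix R)ᵀ ((1 : Equiv.Perm n) i) i = 1 := fun i => by
      rw [hentry]; simp [(hne i).symm]
    have h2 : ∀ i, (1 - t • σ.permMatrix R)ᵀ (σ i) i = -t := fun i => by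
      rw [hentry]; simp [(hne i).symm]
    simp only [h1, h2, Finset.prod_const, Finset.card_univ, hcyc.sign, hsupp]
    have : (-1 : R) ^ Fintype.card n * (-1) ^ Fintype.card n = 1 := by
      rw [← mul_pow]; simp
    simp only [Equiv.Perm.sign_one, Units.val_one, Int.cast_one, one_pow, Units.val_neg,
      Units.val_pow_eq_pow_val, Int.cast_neg, Int.cast_pow, neg_pow t]
    linear_combination (-t ^ Fintype.card n) * this
  · intro τ _ hτ
    simp only [Finset.mem_insert, Finset.mem_singleton, not_or] at hτ
    by_cases hi : ∃ i, τ i ≠ i ∧ τ i ≠ σ i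
    · obtain ⟨i, h1, h2⟩ := hi
      rw [Finset.prod_eq_zero (Finset.mem_univ i), mul_zero]
      rw [hentry]
      simp [h1.symm, h2]
    · push Not at hi
      exfalso
      obtain ⟨i, h1⟩ : ∃ i, τ i ≠ i := by
        by_contra! h
        exact hτ.1 (Equiv.ext h)
      -- Agreement with σ spreads along the orbit: if τ x = σ x, then τ cannot fix σ x, by
      -- injectivity, so it agrees with σ there.
      have key : ∀ m : ℕ, τ ((σ ^ m) i) = σ ((σ ^ m) i) := by
        intro m
        induction m with
        | zero => exact hi i h1
        | succ m ih =>
          apply hi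
          rw [pow_succ', Equiv.Perm.mul_apply, ← ih]
          exact fun h => hne _ (ih.symm.trans (τ.injective h))
      refine hτ.2 (Equiv.ext fun j => ?_)
      obtain ⟨m, -, rfl⟩ := hσ.exists_pow_eq' Set.finite_univ (Set.mem_univ i) (Set.mem_univ j)
      exact key m

-- Right multiplication by g preserves each left coset of ⟨g⟩ and permutes it in a single cycle, so
-- the matrix is block diagonal with equal blocks.
open Classical in
theorem det_one_sub_smul_permMatrix_mulRight {G R : Type*} [Group G] [Fintype G] [CommRing R]
    (g : G) (t : R) :
    (1 - t • (Equiv.mulRight g).permMatrix R).det =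
      (1 - t ^ orderOf g) ^ (Subgroup.zpowers g).index := by
  set H := Subgroup.zpowers g with hH
  let F : H := ⟨g, Subgroup.mem_zpowers g⟩
  -- In the coordinates (coset representative) · (element of H), right multiplication by g moves
  -- only the H-coordinate.
  let φ : H × (G ⧸ H) → G := fun p => p.2.out * p.1
  have hφ : Function.Bijective φ := by
    constructor
    · rintro ⟨h, q⟩ ⟨h', q'⟩ heq
      have hq : q = q' := by
        have h1 := congrArg (QuotientGroup.mk (s := H)) heq
        simpa [φ, QuotientGroup.mk_mul_of_mem] using h1
      subst hq
      simpa [φ] using heq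
    · intro x
      obtain ⟨h, hh⟩ := QuotientGroup.mk_out_eq_mul H x
      exact ⟨(h⁻¹, x), by simp [φ, hh]⟩
  let e := Equiv.ofBijective φ hφ
  have hblock : (1 - t • (Equiv.mulRight g).permMatrix R).submatrix e e =
      blockDiagonal fun _ : G ⧸ H => (1 - t • (Equiv.mulRight F).permMatrix R) := by
    ext ⟨h, q⟩ ⟨h', q'⟩
    have h1 : e (h, q) * g = e (h', q') ↔ h * F = h' ∧ q = q' := by
      rw [← Prod.mk.injEq, ← e.apply_eq_iff_eq]
      simp [e, φ, F, mul_assoc]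
    rw [submatrix_apply, blockDiagonal_apply, one_sub_smul_permMatrix_apply,
      one_sub_smul_permMatrix_apply, e.apply_eq_iff_eq, Equiv.coe_mulRight, Equiv.coe_mulRight,
      Prod.mk.injEq]
    simp only [h1]
    by_cases hq : q = q' <;> simp [hq]
  have hcyc : (Equiv.mulRight F).IsCycleOn Set.univ := by
    refine ⟨by simpa using (Equiv.mulRight F).bijective, ?_⟩
    rintro x - y -
    obtain ⟨i, hi⟩ := Subgroup.mem_zpowers_iff.mp (x⁻¹ * y).2
    refine ⟨i, ?_⟩
    rw [Equiv.zpow_mulRight]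
    ext
    simp [F, hi]
  rw [← det_submatrix_equiv_self e, hblock, det_blockDiagonal,
    det_one_sub_smul_permMatrix_of_isCycleOn _ hcyc, Finset.prod_const, Finset.card_univ,
    Subgroup.index_eq_card, Nat.card_eq_fintype_card, ← Nat.card_eq_fintype_card,
    Nat.card_zpowers]

/-- In the basis of indicator functions, ρ_G(g) has the permutation matrix of x ↦ xg. -/
theorem det_one_sub_smul_rightRegular {k G R : Type*} [Field k] [Group G] [Finite G] [CommRing R]
    [Algebra k R] (g : G) (t : R) :
    LinearMap.det (LinearMap.id - t • (rightRegular k G g).baseChange R) =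
      (1 - t ^ orderOf g) ^ (Subgroup.zpowers g).index := by
  classical
  have := Fintype.ofFinite G
  rw [← det_one_sub_smul_permMatrix_mulRight,
    ← LinearMap.det_toMatrix (Algebra.TensorProduct.basis R (Pi.basisFun k G))]
  congr 1
  ext i j
  rw [one_sub_smul_permMatrix_apply]
  simp [LinearMap.toMatrix_apply, rightRegular, LinearMap.funLeft_apply, Pi.single_apply,
    eq_comm]

end Determinant

/-! ### Convergence of the zeta function -/

section Convergence

variable {H : FinHypergraph V E} {proper : Prop}

theorem exists_primeClass_word (proper : Prop) (H : FinHypergraph V E) :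
    ∃ f : PrimeClass proper H → List (E × V), Function.Injective f ∧
      ∀ c, (f c).length = c.length := by
  refine ⟨fun c => (Quotient.out c).1.2, fun c d h => ?_, fun c => ?_⟩
  · rw [← Quotient.out_eq c, ← Quotient.out_eq d]
    exact Quotient.sound ⟨0, (List.rotate_zero _).trans h⟩
  · conv_rhs => rw [← Quotient.out_eq c]
    rfl

theorem PrimeClass.length_pos (c : PrimeClass proper H) : 0 < c.length := by
  obtain ⟨C, rfl⟩ := Quotient.exists_rep c
  exact zero_lt_one.trans C.2.isCycle.2.1

theorem finite_primeClass_length_le (n : ℕ) :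
    {c : PrimeClass proper H | c.length ≤ n}.Finite := by
  have := H.finite_vertices
  have := H.finite_edges
  obtain ⟨f, hf, hlen⟩ := exists_primeClass_word proper H
  refine Set.Finite.of_injOn (t := {l | l.length ≤ n}) (f := f) ?_ hf.injOn
    (List.finite_length_le _ n)
  intro c hc
  simpa [hlen] using hc

/-- Expand the product into a sum over finite index sets. A set containing i with d i > n
contributes nothing to the n-th coefficient, so each coefficient is a finite sum, whatever the
topology of R. -/
theorem multipliable_one_add_of_X_pow_dvd {ι R : Type*} [CommRing R]
    [TopologicalSpace R] {f : ι → PowerSeries R} {d : ι → ℕ} (hd : ∀ n, {i | d i ≤ n}.Finite)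
    (hf : ∀ i, PowerSeries.X ^ d i ∣ f i) : Multipliable fun i => 1 + f i := by
  refine multipliable_one_add_of_summable_prod
    ((PowerSeries.WithPiTopology.summable_iff_summable_coeff _).mpr fun n =>
      summable_of_hasFiniteSupport ((hd n).toFinset.powerset.finite_toSet.subset ?_))
  intro s hs
  simp only [Finset.coe_powerset, Set.mem_preimage, Set.mem_powerset_iff]
  intro i hi
  by_contra h
  simp only [Set.Finite.coe_toFinset, Set.mem_ofPred_eq, not_le] at h
  exact hs (PowerSeries.X_pow_dvd_iff.mp ((hf i).trans (Finset.dvd_prod_of_mem f hi)) n h)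

/-- Exhibits the factor as 1 plus a small term, as the convergence criteria require. -/
theorem zetaFactor_eq {R : Type*} [CommRing R] {u : R} {c : PrimeClass proper H}
    (hu : IsUnit (1 - u ^ c.length)) :
    zetaFactor H u c = 1 + u ^ c.length * Ring.inverse (1 - u ^ c.length) := by
  have h := Ring.mul_inverse_cancel _ hu
  rw [zetaFactor]
  linear_combination h

theorem multipliable_zetaFactor_X (H : FinHypergraph V E) (k : Type*) [Field k]
    [TopologicalSpace k] :
    Multipliable (zetaFactor (proper := proper) H (PowerSeries.X : PowerSeries k)) := by
  have h : ∀ c : PrimeClass proper H, IsUnit (1 - (PowerSeries.X : PowerSeries k) ^ c.length) := by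
    intro c
    rw [PowerSeries.isUnit_iff_constantCoeff]
    simp [c.length_pos.ne']
  rw [show zetaFactor (proper := proper) H (PowerSeries.X : PowerSeries k) = _ from
    funext fun c => zetaFactor_eq (h c)]
  exact multipliable_one_add_of_X_pow_dvd finite_primeClass_length_le
    fun c => dvd_mul_right _ _

/-- Grouping words by length gives a geometric series of ratio |α| r. -/
theorem summable_pow_length {α : Type*} [Finite α] {r : ℝ} (h0 : 0 ≤ r)
    (hr : Nat.card α * r < 1) : Summable fun l : List α => r ^ l.length := by
  have := Fintype.ofFinite α
  rw [← (Equiv.sigmaFiberEquiv (List.length : List α → ℕ)).summable_iff]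
  have hfin : ∀ n, Finite {l : List α // l.length = n} := fun n =>
    inferInstanceAs (Finite (List.Vector α n))
  refine (summable_sigma_of_nonneg fun _ => pow_nonneg h0 _).mpr
    ⟨fun n => Summable.of_finite, ?_⟩
  have hsum : ∀ n, ∑' l : {l : List α // l.length = n},
      ((fun l : List α => r ^ l.length) ∘ Equiv.sigmaFiberEquiv List.length) ⟨n, l⟩ =
        (Nat.card α * r) ^ n := by
    intro n
    have h1 : ∀ l : {l : List α // l.length = n},
        ((fun l : List α => r ^ l.length) ∘ Equiv.sigmaFiberEquiv List.length) ⟨n, l⟩ = r ^ n :=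
      fun l => congrArg (r ^ ·) l.2
    have h2 : Nat.card {l : List α // l.length = n} = Nat.card α ^ n := by
      rw [Nat.card_eq_fintype_card (α := α), ← card_vector n, ← Nat.card_eq_fintype_card]
      rfl
    rw [tsum_congr h1, tsum_const, h2, nsmul_eq_mul, mul_pow, Nat.cast_pow]
  exact (summable_geometric_of_lt_one (by positivity) hr).congr fun n => (hsum n).symm

/-- The first bound keeps |1 - u^ℓ| ≥ 1/2, so each factor differs from 1 by at most 2|u|^ℓ; the
second makes this summable over all words, hence over classes. -/
theorem multipliable_zetaFactor_complex (H : FinHypergraph V E) {u : ℂ} (hu : ‖u‖ ≤ 1 / 2)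
    (hu' : Nat.card (E × V) * ‖u‖ < 1) : Multipliable (zetaFactor (proper := proper) H u) := by
  have := H.finite_vertices
  have := H.finite_edges
  obtain ⟨f, hf, hlen⟩ := exists_primeClass_word proper H
  have hpow : ∀ c : PrimeClass proper H, ‖u ^ c.length‖ ≤ 1 / 2 := by
    intro c
    rw [norm_pow]
    exact (pow_le_of_le_one (norm_nonneg _) (by linarith) c.length_pos.ne').trans hu
  have hge : ∀ c : PrimeClass proper H, 1 / 2 ≤ ‖1 - u ^ c.length‖ := by
    intro c
    have := norm_sub_norm_le 1 (u ^ c.length)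
    rw [norm_one] at this
    linarith [hpow c]
  have h : ∀ c : PrimeClass proper H, IsUnit (1 - u ^ c.length) := by
    intro c
    rw [isUnit_iff_ne_zero, ← norm_pos_iff]
    linarith [hge c]
  rw [show zetaFactor (proper := proper) H u = _ from funext fun c => zetaFactor_eq (h c)]
  refine multipliable_one_add_of_summable ?_
  have hs := ((summable_pow_length (norm_nonneg u) hu').comp_injective hf).mul_right 2
  refine Summable.of_nonneg_of_le (fun _ => norm_nonneg _) (fun c => ?_) hs
  rw [norm_mul, norm_pow, Ring.inverse_eq_inv', norm_inv, Function.comp_apply, hlen]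
  refine mul_le_mul_of_nonneg_left ?_ (by positivity)
  rw [inv_le_comm₀ (by linarith [hge c]) two_pos]
  linarith [hge c]

end Convergence

/-! ### The `L`-function of the right regular representation -/

section Main

variable {Y : FinHypergraph V E} {X : FinHypergraph V' E'} {π : Hom Y X} {proper : Prop}
  {G : Type*} [Group G] [MulAction G V] [MulAction G E]

/-- The zeta product of `Y` is grouped by classes of `X`. Each inner product is finite with equal
factors, so convergence passes from the zeta function to L. -/
theorem SheetData.hasProd_lFactor_rightRegular (hπ : IsFreeGaloisCovering G π) (D : SheetData π)
    (rep : (c : PrimeClass proper X) → {C : PrimeCycle proper X // Quotient.mk _ C = c})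
    {k R : Type*} [Field k] [CommRing R] [Algebra k R] [TopologicalSpace R] [IsTopologicalRing R]
    {u a : R} (h : HasProd (zetaFactor (proper := proper) Y u) a) :
    HasProd (lFactor D rep (rightRegular k G) u) a := by
  have := hπ.finite
  obtain ⟨e, he⟩ := D.exists_equiv_primeClass hπ rep
  refine ((e.hasProd_iff).mpr h).sigma fun c => ?_
  have := Fintype.ofFinite (G ⧸ Subgroup.zpowers (D.frobenius G (rep c).1))
  have hfac : lFactor D rep (rightRegular k G) u c = ∏ q, (zetaFactor Y u ∘ e) ⟨c, q⟩ := by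
    simp only [Function.comp_apply, zetaFactor, he, Finset.prod_const, Finset.card_univ, lFactor]
    -- `Ring.inverse` commutes with powers even at non-units, so no invertibility is needed.
    rw [det_one_sub_smul_rightRegular, Ring.inverse_pow, ← pow_mul, Subgroup.index_eq_card,
      Nat.card_eq_fintype_card]
  rw [hfac]
  exact hasProd_fintype _

theorem SheetData.lFunction_rightRegular (hπ : IsFreeGaloisCovering G π) (D : SheetData π)
    (rep : (c : PrimeClass proper X) → {C : PrimeCycle proper X // Quotient.mk _ C = c})
    {k R : Type*} [Field k] [CommRing R] [Algebra k R] [TopologicalSpace R] [IsTopologicalRing R]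
    [T2Space R] {u : R} (h : Multipliable (zetaFactor (proper := proper) Y u)) :
    Multipliable (lFactor D rep (rightRegular k G) u) ∧
      Multipliable (zetaFactor (proper := proper) Y u) ∧
      lFunction D rep (rightRegular k G) u = Y.zeta proper u :=
  have hL := D.hasProd_lFactor_rightRegular hπ rep (k := k) h.hasProd
  ⟨hL.multipliable, h, hL.tprod_eq⟩

end Main

end FinHypergraph

theorem mainTheorem4 {V E V' E' G : Type*} [Group G] [MulAction G V] [MulAction G E]
    (Y : FinHypergraph V E) (X : FinHypergraph V' E') (π : FinHypergraph.Hom Y X)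
    (hY : Y.Connected) (hπ : FinHypergraph.IsFreeGaloisCovering G π) (proper : Prop) :
    -- the choices needed for sheet numbers exist, and Frobenius elements are well defined
    Nonempty (FinHypergraph.SheetData π) ∧
    (∀ (D : FinHypergraph.SheetData π) (C : FinHypergraph.PrimeCycle proper X),
      ∃! g : G, D.IsFrobenius C.1.1 C.1.2 g) ∧
    -- for all choices of sheet data and of representatives of the classes of prime cycles
    ∀ (D : FinHypergraph.SheetData π)
      (rep : (c : FinHypergraph.PrimeClass proper X) →
        {C : FinHypergraph.PrimeCycle proper X // Quotient.mk _ C = c}),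
      -- the identity of formal power series over an arbitrary field
      (∀ (k : Type*) [Field k] [TopologicalSpace k] [IsTopologicalRing k] [T2Space k],
        Multipliable (FinHypergraph.lFactor D rep (FinHypergraph.rightRegular k G)
          (PowerSeries.X : PowerSeries k)) ∧
        Multipliable (FinHypergraph.zetaFactor (proper := proper) Y
          (PowerSeries.X : PowerSeries k)) ∧
        FinHypergraph.lFunction D rep (FinHypergraph.rightRegular k G)
          (PowerSeries.X : PowerSeries k) =
            Y.zeta proper (PowerSeries.X : PowerSeries k)) ∧
      -- the identity of functions of a small complex variable
      (∃ r : ℝ, 0 < r ∧ ∀ u : ℂ, ‖u‖ < r →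
        Multipliable (FinHypergraph.lFactor D rep (FinHypergraph.rightRegular ℂ G) u) ∧
        Multipliable (FinHypergraph.zetaFactor (proper := proper) Y u) ∧
        FinHypergraph.lFunction D rep (FinHypergraph.rightRegular ℂ G) u = Y.zeta proper u) := by
  refine ⟨FinHypergraph.nonempty_sheetData hY hπ.onV_surjective,
    fun D C => D.existsUnique_isFrobenius hπ C, fun D rep => ⟨?_, ?_⟩⟩
  · intro k _ _ _ _
    exact D.lFunction_rightRegular hπ rep (FinHypergraph.multipliable_zetaFactor_X Y k)
  · have hpos : (0 : ℝ) < 1 / (Nat.card (E × V) + 2) := by positivity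
    refine ⟨1 / (Nat.card (E × V) + 2), hpos, fun u hu => ?_⟩
    have hle : ‖u‖ * (Nat.card (E × V) + 2) < 1 := (lt_div_iff₀ (by positivity)).mp hu
    refine D.lFunction_rightRegular hπ rep
      (FinHypergraph.multipliable_zetaFactor_complex Y ?_ ?_)
    · nlinarith [norm_nonneg u, (Nat.cast_nonneg (Nat.card (E × V)) : (0 : ℝ) ≤ _)]
    · nlinarith [norm_nonneg u]
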